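/- **Theorem.** Let $d\ge 2$, let $\lambda>0$, and let $\mathbb V_0^{d+1}=\{(x,t)\in\mathbb R^d\times\mathbb R:\ \|x\|=t,\ 0\le t\le 1\}$ be the conic surface, with Lebesgue measure $\mathsf m$ given by $\int f\,d\mathsf m=\int_0^1 t^{d-1}\int_{\mathbb S^{d-1}}f(t\xi,t)\,d\sigma(\xi)\,dt$, where $\sigma$ is the surface measure of the unit sphere $\mathbb S^{d-1}$ and $\omega_d=\sigma(\mathbb S^{d-1})$. A polynomial on the cone is an element of $\mathbb R[x,t]/\langle t^2-\|x\|^2\rangle$; it has degree at most $n$ if it has a representative of total degree at most $n$. Every polynomial on the cone has a unique representative $P(x,t)$ that is harmonic in $x$, i.e. a sum of products $p(t)Y(x)$ with $Y$ a solid harmonic, and $\partial_t$ of it is defined as the class of $\partial P/\partial t$; thus $\partial_t\,[p(t)Y(x)]=p'(t)Y(x)$. Consider the inner products $$\langle f,g\rangle_{-1,-1}=\frac1{\omega_d}\int_{\mathbb V_0^{d+1}}\partial_t f\,\partial_t g\,d\mathsf m+\frac{\lambda}{\omega_d}\int_{\mathbb S^{d-1}}f(\xi,1)g(\xi,1)\,d\sigma(\xi),$$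 $$\langle f,g\rangle_{-1,1}=b\int_{\mathbb V_0^{d+1}}f\,g\,t^{-1}(1-t)\,d\mathsf m,$$ where $b>0$ is the constant with $\langle 1,1\rangle_{-1,1}=1$. For $\gamma\in\{-1,1\}$ and $n\ge0$, let $\mathcal V_n^d(\mathsf w_{-1,\gamma})$ be the space of polynomials on the cone of degree at most $n$ that are orthogonal, with respect to $\langle\cdot,\cdot\rangle_{-1,\gamma}$, to all polynomials of degree at most $n-1$; put $\mathcal V_{-1}^d(\mathsf w_{-1,1})=\{0\}$. Let $\mathcal H_n^{d,0}$ be the space of homogeneous harmonic polynomials of degree $n$ in $x$, regarded as polynomials on the cone. With $(x,t)=(t\xi,t)$, $\xi\in\mathbb S^{d-1}$, let $$\mathcal D_{\gamma}=t(1-t)\frac{d^2}{dt^2}+\bigl(d-1-(d+\gamma)t\bigr)\frac{d}{dt}+t^{-1}\Delta_0^{(\xi)},$$ where $d/dt$ is the derivative of $t\mapsto f(t\xi,t)$ for fixed $\xi$ and $\Delta_0^{(\xi)}$ is the Laplace–Beltrami operator of $\mathbb S^{d-1}$ acting in $\xi$. Then, for every $n=0,1,2,\ldots$, every $Z\in\mathcal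 V_n^d(\mathsf w_{-1,-1})$ satisfies $$\mathcal D_{-1}Z=-n(n+d-2)\,Z\qquad\text{on }\mathbb V_0^{d+1}\setminus\{(0,0)\},$$ and $\mathcal V_n^d(\mathsf w_{-1,-1})$ is the direct sum $$\mathcal V_n^d(\mathsf w_{-1,-1})=\mathcal H_n^{d,0}\oplus(1-t)\,\mathcal V_{n-1}^d(\mathsf w_{-1,1}).$$ -/

import Mathlib

noncomputable section

open MvPolynomial MeasureTheory

/-! ### Polynomials on the conic surface

The variables of `MvPolynomial (Fin (d + 1)) ℝ` are `x₁, …, x_d` (indices `i.castSucc`) and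
`t` (index `Fin.last d`). -/

/-- The quadratic polynomial `t² - ‖x‖²`. -/
def coneQuadric (d : ℕ) : MvPolynomial (Fin (d + 1)) ℝ :=
  X (Fin.last d) ^ 2 - ∑ i : Fin d, X i.castSucc ^ 2

/-- The ring `ℝ[x, t] / ⟨t² - ‖x‖²⟩` of polynomials on the conic surface. -/
abbrev ConePoly (d : ℕ) : Type :=
  MvPolynomial (Fin (d + 1)) ℝ ⧸ Ideal.span {coneQuadric d}

/-- The class of a polynomial in `(x, t)` modulo `t² - ‖x‖²`. -/
def coneMk (d : ℕ) : MvPolynomial (Fin (d + 1)) ℝ →ₐ[ℝ] ConePoly d :=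
  Ideal.Quotient.mkₐ ℝ _

/-- The coordinate `t` as a polynomial on the conic surface. -/
def coneT (d : ℕ) : ConePoly d := coneMk d (X (Fin.last d))

/-- The unit sphere of `ℝ^d`. -/
abbrev UnitSphere (d : ℕ) : Type := Metric.sphere (0 : EuclideanSpace ℝ (Fin d)) 1

/-- The coordinates of the point `(x, t) = (tξ, t)` of the cone. -/
def conePoint {d : ℕ} (ξ : UnitSphere d) (t : ℝ) : Fin (d + 1) → ℝ :=
  Fin.snoc (fun i => t * ξ.1 i) t

theorem aeval_conePoint_coneQuadric {d : ℕ} (ξ : UnitSphere d) (t : ℝ) :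
    aeval (conePoint ξ t) (coneQuadric d) = 0 := by
  have h : ∑ i, ξ.1 i ^ 2 = 1 := by
    rw [← EuclideanSpace.real_norm_sq_eq, norm_eq_of_mem_sphere ξ, one_pow]
  simp [coneQuadric, conePoint, mul_pow, ← Finset.mul_sum, h]

/-- The value of a polynomial on the cone at the point `(tξ, t)`. -/
def coneVal {d : ℕ} (ξ : UnitSphere d) (t : ℝ) : ConePoly d →ₐ[ℝ] ℝ :=
  Ideal.Quotient.liftₐ _ (aeval (conePoint ξ t)) fun p hp => by
    obtain ⟨q, rfl⟩ := Ideal.mem_span_singleton'.1 hp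
    rw [map_mul, aeval_conePoint_coneQuadric, mul_zero]

theorem coneVal_coneMk {d : ℕ} (ξ : UnitSphere d) (t : ℝ) (P : MvPolynomial (Fin (d + 1)) ℝ) :
    coneVal ξ t (coneMk d P) = aeval (conePoint ξ t) P := rfl

/-- The polynomials on the cone of degree at most `n`; this is the zero space if `n < 0`. -/
def conePolyLE (d : ℕ) (n : ℤ) : Submodule ℝ (ConePoly d) :=
  (restrictSupport ℝ {m : Fin (d + 1) →₀ ℕ | (m.degree : ℤ) ≤ n}).map (coneMk d).toLinearMap

/-! ### Integration -/

/-- The surface measure of the unit sphere. -/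
def sphereMeasure (d : ℕ) : Measure (UnitSphere d) :=
  (volume : Measure (EuclideanSpace ℝ (Fin d))).toSphere

instance (d : ℕ) : IsFiniteMeasure (sphereMeasure d) := by
  unfold sphereMeasure; infer_instance

/-- The surface area `ω_d` of the unit sphere. -/
def sphereArea (d : ℕ) : ℝ := (sphereMeasure d).real Set.univ

/-- The integral over the conic surface `{(x, t) : ‖x‖ = t, 0 ≤ t ≤ 1}` with respect to its
Lebesgue measure, `∫ f dm = ∫₀¹ t^(d-1) ∫ f(tξ, t) dσ(ξ) dt`, for `f` given as a function
of `(ξ, t)`. -/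
def coneIntegral (d : ℕ) (f : UnitSphere d → ℝ → ℝ) : ℝ :=
  ∫ t in (0 : ℝ)..1, t ^ (d - 1) * ∫ ξ, f ξ t ∂(sphereMeasure d)

/-- The Jacobi weight `t^β (1 - t)^γ`. -/
def jacobiWeight (β γ t : ℝ) : ℝ := t ^ β * (1 - t) ^ γ

theorem continuous_coneVal {d : ℕ} (u : ConePoly d) :
    Continuous fun p : ℝ × UnitSphere d => coneVal p.2 p.1 u := by
  obtain ⟨P, rfl⟩ := Ideal.Quotient.mkₐ_surjective ℝ _ u
  change Continuous fun p : ℝ × UnitSphere d => aeval (conePoint p.2 p.1) P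
  have h : Continuous fun p : ℝ × UnitSphere d => conePoint p.2 p.1 := by
    refine continuous_pi fun i => ?_
    refine Fin.lastCases ?_ (fun j => ?_) i
    · simpa [conePoint] using continuous_fst
    · simp only [conePoint, Fin.snoc_castSucc]
      fun_prop
  exact (MvPolynomial.continuous_eval P).comp h

theorem intervalIntegrable_jacobi {a c : ℝ} (ha : -1 < a) (hc : -1 < c) :
    IntervalIntegrable (fun t : ℝ => t ^ a * (1 - t) ^ c) volume 0 1 := by
  have h := (Complex.betaIntegral_convergent (u := (a + 1 : ℝ)) (v := (c + 1 : ℝ))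
    (by simp; linarith) (by simp; linarith)).norm
  rw [intervalIntegrable_iff_integrableOn_Ioo_of_le zero_le_one] at h ⊢
  refine h.congr_fun (fun t ht => ?_) measurableSet_Ioo
  have h1 : (0 : ℝ) < 1 - t := sub_pos.2 ht.2
  have e : (1 : ℂ) - (t : ℂ) = ((1 - t : ℝ) : ℂ) := by push_cast; rfl
  simp only [norm_mul]
  rw [e, Complex.norm_cpow_eq_rpow_re_of_pos ht.1, Complex.norm_cpow_eq_rpow_re_of_pos h1]
  simp

/-- The integrals that define the inner products converge. -/
theorem intervalIntegrable_cone {d : ℕ} (hd : 2 ≤ d) {β γ : ℝ} (hβ : -(d : ℝ) < β) (hγ : -1 < γ)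
    (u : ConePoly d) :
    IntervalIntegrable (fun t : ℝ => t ^ (d - 1) *
      ∫ ξ, coneVal ξ t u * jacobiWeight β γ t ∂(sphereMeasure d)) volume 0 1 := by
  have hd' : ((d - 1 : ℕ) : ℝ) = (d : ℝ) - 1 := by
    rw [Nat.cast_sub (by omega)]; simp
  have hc : Continuous fun t : ℝ => ∫ ξ, coneVal ξ t u ∂(sphereMeasure d) := by
    have := continuous_parametric_integral_of_continuous (μ := sphereMeasure d)
      (f := fun (t : ℝ) (ξ : UnitSphere d) => coneVal ξ t u) (continuous_coneVal u)
      (s := Set.univ) isCompact_univ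
    simpa using this
  have h := (intervalIntegrable_jacobi (a := (d - 1 : ℕ) + β) (c := γ)
    (by rw [hd']; linarith) hγ).mul_continuousOn hc.continuousOn
  rw [intervalIntegrable_iff_integrableOn_Ioo_of_le zero_le_one] at h ⊢
  refine h.congr_fun (fun t ht => ?_) measurableSet_Ioo
  simp only [jacobiWeight]
  rw [integral_mul_const, Real.rpow_add ht.1, Real.rpow_natCast]
  ring

/-- The linear functional `u ↦ ∫ u(x, t) t^β (1 - t)^γ dm(x, t)` over the conic surface. -/
def coneWeightedIntegral {d : ℕ} (hd : 2 ≤ d) {β γ : ℝ} (hβ : -(d : ℝ) < β) (hγ : -1 < γ) :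
    ConePoly d →ₗ[ℝ] ℝ where
  toFun u := coneIntegral d fun ξ t => coneVal ξ t u * jacobiWeight β γ t
  map_add' u v := by
    unfold coneIntegral
    rw [← intervalIntegral.integral_add (intervalIntegrable_cone hd hβ hγ u)
      (intervalIntegrable_cone hd hβ hγ v)]
    refine intervalIntegral.integral_congr fun t _ => ?_
    have hi : ∀ w : ConePoly d,
        Integrable (fun ξ => coneVal ξ t w) (sphereMeasure d) := fun w =>
      ((continuous_coneVal w).comp (by fun_prop :
        Continuous fun ξ : UnitSphere d => (t, ξ))).integrable_of_hasCompactSupport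
        (HasCompactSupport.of_compactSpace _)
    simp only [integral_mul_const, map_add, integral_add (hi u) (hi v)]
    ring
  map_smul' c u := by
    unfold coneIntegral
    rw [RingHom.id_apply, smul_eq_mul, ← intervalIntegral.integral_const_mul]
    refine intervalIntegral.integral_congr fun t _ => ?_
    simp only [integral_mul_const, map_smul, smul_eq_mul, integral_const_mul]
    ring

/-- The linear functional `u ↦ ∫ u(ξ, 1) dσ(ξ)` over the unit sphere. -/
def coneBoundaryIntegral (d : ℕ) : ConePoly d →ₗ[ℝ] ℝ where
  toFun u := ∫ ξ, coneVal ξ 1 u ∂(sphereMeasure d)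
  map_add' u v := by
    have hi : ∀ w : ConePoly d,
        Integrable (fun ξ => coneVal ξ 1 w) (sphereMeasure d) := fun w =>
      ((continuous_coneVal w).comp (by fun_prop :
        Continuous fun ξ : UnitSphere d => ((1 : ℝ), ξ))).integrable_of_hasCompactSupport
        (HasCompactSupport.of_compactSpace _)
    simp only [map_add, integral_add (hi u) (hi v)]
  map_smul' c u := by
    simp only [map_smul, smul_eq_mul, integral_const_mul, RingHom.id_apply]

/-! ### The derivative `∂/∂t` on the conic surface

A polynomial on the cone is, in exactly one way, the restriction of a polynomial `P(x, t)` that is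
harmonic in `x`, that is, of a sum of products `p(t) Y(x)` with `Y` a solid harmonic. The
derivative `∂/∂t` on the cone is `∂_{d+1}` applied to this representation, so that
`∂/∂t (p(t) Y(x)) = p'(t) Y(x)`. -/

/-- The Laplace operator in the variables `x`. -/
def xLaplacian (d : ℕ) :
    MvPolynomial (Fin (d + 1)) ℝ →ₗ[ℝ] MvPolynomial (Fin (d + 1)) ℝ :=
  ∑ i : Fin d, (pderiv i.castSucc).toLinearMap ∘ₗ (pderiv i.castSucc).toLinearMap

/-- The polynomials in `(x, t)` that are harmonic in `x`. -/
def xHarmonic (d : ℕ) : Submodule ℝ (MvPolynomial (Fin (d + 1)) ℝ) :=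
  LinearMap.ker (xLaplacian d)

theorem xLaplacian_apply {d : ℕ} (q : MvPolynomial (Fin (d + 1)) ℝ) :
    xLaplacian d q = ∑ i : Fin d, pderiv i.castSucc (pderiv i.castSucc q) := by
  simp [xLaplacian, LinearMap.sum_apply]

theorem pderiv_pderiv_comm {σ : Type*} (i j : σ) (q : MvPolynomial σ ℝ) :
    pderiv i (pderiv j q) = pderiv j (pderiv i q) := by
  classical
  ext m
  simp only [coeff_pderiv, add_right_comm m, Finsupp.add_apply, Finsupp.single_apply]
  by_cases h : i = j
  · subst h; rfl
  · simp [h, Ne.symm h]; ring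

/-- The Euler operator `∑ xᵢ ∂ᵢ` in the variables `x`. -/
def xEuler (d : ℕ) (q : MvPolynomial (Fin (d + 1)) ℝ) : MvPolynomial (Fin (d + 1)) ℝ :=
  ∑ i : Fin d, X i.castSucc * pderiv i.castSucc q

theorem xLaplacian_coneQuadric_mul {d : ℕ} (q : MvPolynomial (Fin (d + 1)) ℝ) :
    xLaplacian d (coneQuadric d * q) =
      coneQuadric d * xLaplacian d q - (2 * (d : MvPolynomial (Fin (d + 1)) ℝ) * q
        + 4 * xEuler d q) := by
  have h1 : ∀ i : Fin d, pderiv i.castSucc (coneQuadric d) = -2 * X i.castSucc := by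
    intro i
    have hne : Fin.last d ≠ i.castSucc := (Fin.castSucc_lt_last i).ne'
    simp only [coneQuadric, map_sub, map_sum, Derivation.leibniz_pow, pderiv_X_of_ne hne]
    rw [Finset.sum_eq_single i]
    · simp
    · intro j _ hj
      rw [pderiv_X_of_ne (by simpa using hj)]; simp
    · simp
  have h2 : ∀ i : Fin d, pderiv i.castSucc (pderiv i.castSucc (coneQuadric d * q)) =
      coneQuadric d * pderiv i.castSucc (pderiv i.castSucc q) - (2 * q
        + 4 * (X i.castSucc * pderiv i.castSucc q)) := by
    intro i
    have h3 : pderiv i.castSucc (-2 * X i.castSucc : MvPolynomial (Fin (d + 1)) ℝ) = -2 := by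
      have : (-2 : MvPolynomial (Fin (d + 1)) ℝ) = C (-2) := by
        rw [map_neg, map_ofNat]
      rw [this, pderiv_C_mul, pderiv_X_self, mul_one]
    simp only [pderiv_mul, map_add, h1, h3]
    ring
  simp only [xLaplacian_apply, h2, Finset.sum_sub_distrib, Finset.sum_add_distrib, xEuler,
    Finset.mul_sum, Finset.sum_const, Finset.card_univ, Fintype.card_fin, nsmul_eq_mul]
  ring

theorem xLaplacian_xEuler {d : ℕ} (q : MvPolynomial (Fin (d + 1)) ℝ) :
    xLaplacian d (xEuler d q) = xEuler d (xLaplacian d q) + 2 * xLaplacian d q := by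
  have h : ∀ i j : Fin d, pderiv i.castSucc (pderiv i.castSucc
      (X j.castSucc * pderiv j.castSucc q)) =
      X j.castSucc * pderiv j.castSucc (pderiv i.castSucc (pderiv i.castSucc q)) +
        if i = j then 2 * pderiv i.castSucc (pderiv i.castSucc q) else 0 := by
    intro i j
    rw [pderiv_pderiv_comm j.castSucc i.castSucc (pderiv i.castSucc q),
      pderiv_pderiv_comm j.castSucc i.castSucc q]
    by_cases hij : i = j
    · subst hij
      simp; ring
    · have hne : j.castSucc ≠ i.castSucc := by simpa using Ne.symm hij
      simp [pderiv_X_of_ne hne, hij]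
  simp only [xLaplacian_apply, xEuler, map_sum, h, Finset.sum_add_distrib, Finset.mul_sum]
  rw [Finset.sum_comm]
  simp

theorem coeff_xEuler {d : ℕ} (q : MvPolynomial (Fin (d + 1)) ℝ) (m : Fin (d + 1) →₀ ℕ) :
    coeff m (xEuler d q) = (∑ i : Fin d, (m i.castSucc : ℝ)) * coeff m q := by
  classical
  simp only [xEuler, coeff_sum, Finset.sum_mul]
  refine Finset.sum_congr rfl fun i _ => ?_
  rw [coeff_X_mul']
  split_ifs with hi
  · have h1 : m - Finsupp.single i.castSucc 1 + Finsupp.single i.castSucc 1 = m := by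
      ext k
      by_cases hk : k = i.castSucc
      · subst hk
        have := Finsupp.mem_support_iff.1 hi
        simp; omega
      · simp [Ne.symm hk]
    rw [coeff_pderiv, h1]
    have h2 : m i.castSucc ≠ 0 := Finsupp.mem_support_iff.1 hi
    have h3 : (m - Finsupp.single i.castSucc 1 : Fin (d + 1) →₀ ℕ) i.castSucc + 1 = m i.castSucc := by
      simp; omega
    rw [← h3]; push_cast; ring
  · simp [Finsupp.notMem_support_iff.1 hi]

theorem degree_of_mem_support_xLaplacian {d : ℕ} {q : MvPolynomial (Fin (d + 1)) ℝ} {N : ℕ}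
    (hq : ∀ m ∈ q.support, m.degree < N + 2) : ∀ m ∈ (xLaplacian d q).support, m.degree < N := by
  intro m hm
  rw [mem_support_iff, xLaplacian_apply, coeff_sum] at hm
  obtain ⟨i, -, hi⟩ := Finset.exists_ne_zero_of_sum_ne_zero hm
  rw [coeff_pderiv, coeff_pderiv] at hi
  have h := hq _ (mem_support_iff.2 (left_ne_zero_of_mul (left_ne_zero_of_mul hi)))
  simp only [map_add, Finsupp.degree_single] at h
  omega

theorem eq_zero_of_coneQuadric_mul_xLaplacian {d : ℕ} (N : ℕ) :
    ∀ (q : MvPolynomial (Fin (d + 1)) ℝ) (c a : ℝ), (∀ m ∈ q.support, m.degree < N) → 0 < c →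
      0 ≤ a → coneQuadric d * xLaplacian d q = C c * q + C a * xEuler d q → q = 0 := by
  induction N with
  | zero =>
    intro q c a hq _ _ _
    rw [← support_eq_empty]
    exact Finset.eq_empty_of_forall_notMem fun m hm => absurd (hq m hm) (by simp)
  | succ N ih =>
    intro q c a hq hc ha h
    have hr : xLaplacian d q = 0 := by
      refine ih _ (c + 2 * d + 2 * a) (a + 4)
        (fun m hm => degree_of_mem_support_xLaplacian (N := N)
          (fun k hk => (hq k hk).trans (by omega)) m hm) (by positivity) (by positivity) ?_
      have h' := congrArg (xLaplacian d) h
      rw [xLaplacian_coneQuadric_mul, map_add, ← smul_eq_C_mul, ← smul_eq_C_mul, map_smul,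
        map_smul, xLaplacian_xEuler, smul_eq_C_mul, smul_eq_C_mul] at h'
      have e1 : (C (c + 2 * d + 2 * a) : MvPolynomial (Fin (d + 1)) ℝ) =
          C c + 2 * (d : MvPolynomial (Fin (d + 1)) ℝ) + 2 * C a := by
        simp only [map_add, map_mul, map_ofNat, map_natCast]
      have e2 : (C (a + 4) : MvPolynomial (Fin (d + 1)) ℝ) = C a + 4 := by
        rw [map_add, map_ofNat]
      rw [e1, e2]
      linear_combination h'
    rw [hr, mul_zero] at h
    ext m
    have hm := congrArg (coeff m) h
    rw [coeff_add, coeff_C_mul, coeff_C_mul, coeff_xEuler, coeff_zero] at hm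
    have hp : 0 < c + a * ∑ i : Fin d, (m i.castSucc : ℝ) := by positivity
    have : (c + a * ∑ i : Fin d, (m i.castSucc : ℝ)) * coeff m q = 0 := by linarith
    simpa [hp.ne'] using this

theorem eq_zero_of_xLaplacian_coneQuadric_mul {d : ℕ} (hd : 2 ≤ d)
    {q : MvPolynomial (Fin (d + 1)) ℝ} (h : xLaplacian d (coneQuadric d * q) = 0) : q = 0 := by
  refine eq_zero_of_coneQuadric_mul_xLaplacian (q.totalDegree + 1) q (2 * d) 4
    (fun m hm => Nat.lt_succ_of_le ?_) (by positivity) (by norm_num) ?_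
  · simpa [Finsupp.degree_eq_sum, Finsupp.sum_fintype] using le_totalDegree hm
  · rw [xLaplacian_coneQuadric_mul] at h
    have e1 : (C (2 * d) : MvPolynomial (Fin (d + 1)) ℝ) = 2 * d := by
      rw [map_mul, map_ofNat, map_natCast]
    have e2 : (C 4 : MvPolynomial (Fin (d + 1)) ℝ) = 4 := map_ofNat C 4
    rw [e1, e2]
    linear_combination h

theorem xLaplacian_coneQuadric_mul_surjective {d : ℕ} (hd : 2 ≤ d)
    (p : MvPolynomial (Fin (d + 1)) ℝ) : ∃ q, xLaplacian d (coneQuadric d * q) = p := by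
  let N := p.totalDegree
  let T : MvPolynomial (Fin (d + 1)) ℝ →ₗ[ℝ] MvPolynomial (Fin (d + 1)) ℝ :=
    xLaplacian d ∘ₗ LinearMap.mulLeft ℝ (coneQuadric d)
  have hQ : (coneQuadric d).totalDegree ≤ 2 := by
    refine (totalDegree_sub _ _).trans (max_le ?_ ?_)
    · simp [totalDegree_X_pow]
    · exact totalDegree_finsetSum_le fun i _ => by simp [totalDegree_X_pow]
  have hT : ∀ q ∈ restrictTotalDegree (Fin (d + 1)) ℝ N,
      T q ∈ restrictTotalDegree (Fin (d + 1)) ℝ N := by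
    intro q hq
    rw [mem_restrictTotalDegree] at hq ⊢
    have h1 : (coneQuadric d * q).totalDegree ≤ N + 2 :=
      (totalDegree_mul _ _).trans (by omega)
    have h2 := degree_of_mem_support_xLaplacian (q := coneQuadric d * q) (N := N + 1)
      fun m hm => by
        have := le_totalDegree hm
        rw [Finsupp.degree_eq_sum]
        rw [Finsupp.sum_fintype _ _ (by simp)] at this
        omega
    refine Finset.sup_le fun m hm => ?_
    have := h2 m hm
    rw [Finsupp.degree_eq_sum] at this
    rw [Finsupp.sum_fintype _ _ (by simp)]
    omega
  have hi : Function.Injective (T.restrict hT) := by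
    rw [injective_iff_map_eq_zero]
    intro q hq
    exact Subtype.ext (eq_zero_of_xLaplacian_coneQuadric_mul hd (congrArg Subtype.val hq))
  obtain ⟨q, hq⟩ := LinearMap.injective_iff_surjective.1 hi
    ⟨p, (mem_restrictTotalDegree _ _ _).2 le_rfl⟩
  exact ⟨q.1, congrArg Subtype.val hq⟩

/-- Every polynomial on the cone has exactly one representative that is harmonic in `x`. -/
theorem xHarmonic_bijective {d : ℕ} (hd : 2 ≤ d) :
    Function.Bijective ((coneMk d).toLinearMap ∘ₗ (xHarmonic d).subtype) := by
  constructor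
  · rw [injective_iff_map_eq_zero]
    rintro ⟨P, hP⟩ h
    obtain ⟨q, rfl⟩ := Ideal.mem_span_singleton.1 (Ideal.Quotient.eq_zero_iff_mem.1 h)
    have : q = 0 := eq_zero_of_xLaplacian_coneQuadric_mul hd hP
    simp [this]
  · intro u
    obtain ⟨P, rfl⟩ := Ideal.Quotient.mkₐ_surjective ℝ _ u
    obtain ⟨q, hq⟩ := xLaplacian_coneQuadric_mul_surjective hd (xLaplacian d P)
    refine ⟨⟨P - coneQuadric d * q, ?_⟩, ?_⟩
    · simp [xHarmonic, hq]
    · refine Ideal.Quotient.eq.2 ?_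
      rw [Ideal.mem_span_singleton]
      exact ⟨-q, by simp⟩

/-- The representative of a polynomial on the cone that is harmonic in `x`. -/
def harmonicRep {d : ℕ} (hd : 2 ≤ d) : ConePoly d ≃ₗ[ℝ] xHarmonic d :=
  (LinearEquiv.ofBijective _ (xHarmonic_bijective hd)).symm

/-- The derivative `∂/∂t` on the conic surface. -/
def coneDt {d : ℕ} (hd : 2 ≤ d) : ConePoly d →ₗ[ℝ] ConePoly d :=
  (coneMk d).toLinearMap ∘ₗ (pderiv (Fin.last d)).toLinearMap ∘ₗ (xHarmonic d).subtype ∘ₗ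
    (harmonicRep hd).toLinearMap

/-- The defining property of `∂/∂t`: if `P(x, t)` is harmonic in `x`, then `∂/∂t` of its
restriction to the cone is the restriction of `∂_{d+1} P`. -/
theorem coneDt_coneMk {d : ℕ} (hd : 2 ≤ d) {P : MvPolynomial (Fin (d + 1)) ℝ}
    (hP : P ∈ xHarmonic d) : coneDt hd (coneMk d P) = coneMk d (pderiv (Fin.last d) P) := by
  have h : harmonicRep hd (coneMk d P) = ⟨P, hP⟩ :=
    (LinearEquiv.symm_apply_eq _).2 rfl
  simp [coneDt, h]

/-! ### Orthogonal polynomials on the conic surface -/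

/-- The normalization constant
`b_{β,γ} = ω_d⁻¹ Γ(β + γ + d + 1) / (Γ(β + d) Γ(γ + 1))`, for which `⟨1, 1⟩_{β,γ} = 1`. -/
def coneNorm (d : ℕ) (β γ : ℝ) : ℝ :=
  (sphereArea d)⁻¹ * (Real.Gamma (β + γ + d + 1) / (Real.Gamma (β + d) * Real.Gamma (γ + 1)))

/-- The inner product `⟨f, g⟩_{β,γ} = b_{β,γ} ∫ f g t^β (1 - t)^γ dm`, for `β > -d` and
`γ > -1`. -/
def jacobiInner {d : ℕ} (hd : 2 ≤ d) (β γ : ℝ) (hβ : -(d : ℝ) < β) (hγ : -1 < γ) :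
    LinearMap.BilinForm ℝ (ConePoly d) :=
  coneNorm d β γ • (LinearMap.mul ℝ (ConePoly d)).compr₂ (coneWeightedIntegral hd hβ hγ)

/-- The Sobolev inner product
`⟨f, g⟩_{β,-1} = ω_d⁻¹ ∫ ∂f/∂t ∂g/∂t t^(β+1) dm + λ ω_d⁻¹ ∫ f(ξ, 1) g(ξ, 1) dσ(ξ)`,
for `β > -d - 1`. -/
def sobolevInner {d : ℕ} (hd : 2 ≤ d) (β : ℝ) (hβ : -(d : ℝ) < β + 1) (lam : ℝ) :
    LinearMap.BilinForm ℝ (ConePoly d) :=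
  (sphereArea d)⁻¹ • ((LinearMap.mul ℝ (ConePoly d)).compr₂
      (coneWeightedIntegral hd hβ (by norm_num : (-1 : ℝ) < 0))).compl₁₂ (coneDt hd) (coneDt hd)
    + (lam * (sphereArea d)⁻¹) •
      (LinearMap.mul ℝ (ConePoly d)).compr₂ (coneBoundaryIntegral d)

/-- The space of orthogonal polynomials of degree `n` for `B`: the polynomials on the cone of
degree at most `n` that are orthogonal to all those of degree at most `n - 1`. It is the zero
space if `n < 0`. -/
def orthPoly {d : ℕ} (B : LinearMap.BilinForm ℝ (ConePoly d)) (n : ℤ) :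
    Submodule ℝ (ConePoly d) :=
  conePolyLE d n ⊓ B.orthogonal (conePolyLE d (n - 1))

/-- The space `V_n^d(w_{β,γ})` for `β > -d` and `γ > -1`. -/
def jacobiSpace {d : ℕ} (hd : 2 ≤ d) (β γ : ℝ) (hβ : -(d : ℝ) < β) (hγ : -1 < γ) (n : ℤ) :
    Submodule ℝ (ConePoly d) :=
  orthPoly (jacobiInner hd β γ hβ hγ) n

/-- The space `V_n^d(w_{β,-1})` of Sobolev orthogonal polynomials, for `β > -d - 1`. -/
def sobolevSpace {d : ℕ} (hd : 2 ≤ d) (β : ℝ) (hβ : -(d : ℝ) < β + 1) (lam : ℝ) (n : ℤ) :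
    Submodule ℝ (ConePoly d) :=
  orthPoly (sobolevInner hd β hβ lam) n

/-! ### Solid harmonics and the differential operator -/

/-- The homogeneous harmonic polynomials of degree `n` in `x₁, …, x_d`. -/
def solidHarmonic (d n : ℕ) : Submodule ℝ (MvPolynomial (Fin d) ℝ) :=
  homogeneousSubmodule (Fin d) ℝ n ⊓
    LinearMap.ker (∑ i : Fin d, (pderiv i).toLinearMap ∘ₗ (pderiv i).toLinearMap)

/-- The space `H_n^{d,0}` of solid harmonics `Y(x)`, as polynomials on the cone. -/
def coneSolidHarmonic (d n : ℕ) : Submodule ℝ (ConePoly d) :=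
  (solidHarmonic d n).map ((coneMk d).comp (rename Fin.castSucc)).toLinearMap

open Classical in
/-- The function `y ↦ h(y / ‖y‖)` on `ℝ^d`, with the value `0` at the origin. -/
def radialExtension {d : ℕ} (h : UnitSphere d → ℝ) (y : EuclideanSpace ℝ (Fin d)) : ℝ :=
  if hy : y = 0 then 0
  else h ⟨‖y‖⁻¹ • y, by simp [norm_smul, hy]⟩

/-- The Laplace–Beltrami operator `Δ₀` of the unit sphere: the restriction to the sphere of the
Laplacian of `y ↦ h(y / ‖y‖)`. -/
def laplaceBeltrami {d : ℕ} (h : UnitSphere d → ℝ) (ξ : UnitSphere d) : ℝ :=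
  Laplacian.laplacian (radialExtension h) ξ.1

/-- The differential operator
`D_γ = t(1 - t) d²/dt² + (d - 1 - (d + γ) t) d/dt + t⁻¹ Δ₀^{(ξ)}`
acting on a function `f` of `(ξ, t)`, where `(x, t) = (tξ, t)`. -/
def coneOperator (d : ℕ) (γ : ℝ) (f : UnitSphere d → ℝ → ℝ) (ξ : UnitSphere d) (t : ℝ) : ℝ :=
  t * (1 - t) * iteratedDeriv 2 (f ξ) t + (d - 1 - (d + γ) * t) * deriv (f ξ) t
    + t⁻¹ * laplaceBeltrami (fun η => f η t) ξ

theorem neg_natCast_lt_neg_one {d : ℕ} (hd : 2 ≤ d) : -(d : ℝ) < -1 := by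
  have : (2 : ℝ) ≤ d := by exact_mod_cast hd
  linarith

theorem neg_natCast_lt_neg_one_add_one {d : ℕ} (hd : 2 ≤ d) : -(d : ℝ) < -1 + 1 := by
  have := neg_natCast_lt_neg_one hd
  linarith

end

noncomputable section

open MvPolynomial MeasureTheory

/-!
Every polynomial on the cone is represented by a polynomial `P(x, t)` harmonic in `x`. On these
representatives `D_{-1} = (1 - t) R - S`, where `R = t ∂ₜ² + (d - 1 + 2 E) ∂ₜ`, `S = E² + (d - 2) E`
and `E` is the Euler operator in `x`. Integrating by parts along the rays gives
`⟨D_{-1} P, Q⟩_{-1,-1} = ⟨P, D_{-1} Q⟩_{-1,-1}`, and `D_{-1}` acts on the part of top degree `n` as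
multiplication by `-n (n + d - 2)`; a polynomial of degree `n` orthogonal to all lower degrees is
therefore an eigenvector.

The same integration by parts shows that `⟨(1 - t) P, Q⟩_{-1,-1}` is a negative multiple of
`⟨P, R Q⟩_{-1,1}`. Since `R` maps degree `n` onto degree `n - 1`, the polynomial `(1 - t) P` lies in
`V_n(w_{-1,-1})` if and only if `P` lies in `V_{n-1}(w_{-1,1})`. For `Y` harmonic in `x`, only the
boundary term of `⟨Y, Z⟩_{-1,-1}` is left; hence the solid harmonics of degree `n` lie in
`V_n(w_{-1,-1})`, and the restriction of any `Z ∈ V_n(w_{-1,-1})` to `t = 1` is one of them.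
-/

/-! ### The degree filtration -/

section DegreeFiltration

variable {σ R : Type*}

/-- The polynomials of total degree at most `n`, for an integer `n`, so that the polynomials of
degree at most `n - 1` make sense for `n = 0` (they form the zero space). -/
def polyLE (σ R : Type*) [CommSemiring R] (n : ℤ) : Submodule R (MvPolynomial σ R) :=
  restrictSupport R {m : σ →₀ ℕ | (m.degree : ℤ) ≤ n}

section CommSemiring

variable [CommSemiring R] {n k : ℤ} {P Q : MvPolynomial σ R}

theorem mem_polyLE : P ∈ polyLE σ R n ↔ ∀ m, coeff m P ≠ 0 → (m.degree : ℤ) ≤ n := by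
  rw [polyLE, mem_restrictSupport_iff]
  exact ⟨fun h m hm => h (mem_support_iff.2 hm), fun h m hm => h m (mem_support_iff.1 hm)⟩

theorem mem_polyLE_natCast {n : ℕ} : P ∈ polyLE σ R n ↔ P.totalDegree ≤ n := by
  simp only [mem_polyLE, totalDegree, Finset.sup_le_iff, mem_support_iff, Nat.cast_le]
  rfl

theorem polyLE_natCast (n : ℕ) : polyLE σ R n = restrictTotalDegree σ R n := by
  ext P
  rw [mem_polyLE_natCast, mem_restrictTotalDegree]

theorem polyLE_mono (h : n ≤ k) : polyLE σ R n ≤ polyLE σ R k :=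
  restrictSupport_mono R fun _ hm => le_trans hm h

theorem eq_zero_of_mem_polyLE_of_neg (hn : n < 0) (hP : P ∈ polyLE σ R n) : P = 0 := by
  rw [mem_polyLE] at hP
  ext m
  by_contra h
  have := hP m h
  omega

theorem X_mem_polyLE (i : σ) : (X i : MvPolynomial σ R) ∈ polyLE σ R 1 := by
  classical
  rw [mem_polyLE]
  intro m hm
  rw [coeff_X] at hm
  rw [← (ite_ne_right_iff.1 hm).1, Finsupp.degree_single, Nat.cast_one]

theorem mul_mem_polyLE (hP : P ∈ polyLE σ R n) (hQ : Q ∈ polyLE σ R k) :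
    P * Q ∈ polyLE σ R (n + k) := by
  classical
  rw [mem_polyLE] at *
  intro m hm
  rw [coeff_mul] at hm
  obtain ⟨⟨a, b⟩, hab, h⟩ := Finset.exists_ne_zero_of_sum_ne_zero hm
  rw [← Finset.HasAntidiagonal.mem_antidiagonal.1 hab, map_add, Nat.cast_add]
  exact add_le_add (hP a (left_ne_zero_of_mul h)) (hQ b (right_ne_zero_of_mul h))

theorem pderiv_mem_polyLE (i : σ) (hP : P ∈ polyLE σ R n) : pderiv i P ∈ polyLE σ R (n - 1) := by
  rw [mem_polyLE] at *
  intro m hm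
  rw [coeff_pderiv] at hm
  have := hP _ (left_ne_zero_of_mul hm)
  rw [map_add, Finsupp.degree_single] at this
  omega

end CommSemiring

section CommRing

variable [CommRing R] {P : MvPolynomial σ R}

theorem one_sub_X_mul_mem_polyLE (i : σ) {n : ℤ} (hP : P ∈ polyLE σ R (n - 1)) :
    (1 - X i) * P ∈ polyLE σ R n := by
  rw [sub_mul, one_mul]
  refine sub_mem (polyLE_mono (by omega) hP) ?_
  simpa using mul_mem_polyLE (X_mem_polyLE i) hP

theorem totalDegree_one_sub_X [Nontrivial R] (i : σ) :
    (1 - X i : MvPolynomial σ R).totalDegree = 1 := by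
  rw [sub_eq_add_neg, totalDegree_add_eq_right_of_totalDegree_lt] <;> simp

theorem one_sub_X_ne_zero [Nontrivial R] (i : σ) : (1 - X i : MvPolynomial σ R) ≠ 0 :=
  ne_zero_of_map (f := constantCoeff) (by simp)

theorem mem_polyLE_of_one_sub_X_mul [IsDomain R] (i : σ) {n : ℤ}
    (h : (1 - X i) * P ∈ polyLE σ R n) : P ∈ polyLE σ R (n - 1) := by
  rcases eq_or_ne P 0 with rfl | hP
  · exact zero_mem _
  have hn : 0 ≤ n := by
    by_contra! hn
    exact mul_ne_zero (one_sub_X_ne_zero i) hP (eq_zero_of_mem_polyLE_of_neg hn h)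
  lift n to ℕ using hn
  rw [mem_polyLE_natCast, totalDegree_mul_of_isDomain (one_sub_X_ne_zero i) hP,
    totalDegree_one_sub_X] at h
  exact polyLE_mono (by omega) (mem_polyLE_natCast.2 le_rfl)

end CommRing

end DegreeFiltration

/-! ### Harmonic polynomials -/

theorem aeval_smul_of_isHomogeneous {σ R S : Type*} [CommSemiring R] [CommSemiring S]
    [Algebra R S] {k : ℕ} {P : MvPolynomial σ R} (hP : P.IsHomogeneous k) (r : R) (x : σ → S) :
    aeval (r • x) P = r ^ k • aeval x P := by
  simp only [aeval_def, eval₂_eq, Finset.smul_sum, Pi.smul_apply, smul_pow, Finset.prod_smul,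
    Finset.prod_pow_eq_pow_sum, mul_smul_comm]
  exact Finset.sum_congr rfl fun m hm => by rw [← hP.degree_eq_sum_deg_support hm]

theorem eval_smul_of_isHomogeneous {σ R : Type*} [CommSemiring R] {k : ℕ} {P : MvPolynomial σ R}
    (hP : P.IsHomogeneous k) (r : R) (x : σ → R) : eval (r • x) P = r ^ k * eval x P := by
  simpa only [aeval_eq_eval, smul_eq_mul] using aeval_smul_of_isHomogeneous hP r x

theorem hasDerivAt_eval {𝕜 σ : Type*} [NontriviallyNormedField 𝕜] [Fintype σ] {γ : 𝕜 → σ → 𝕜}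
    {γ' : σ → 𝕜} {t : 𝕜} (h : ∀ i, HasDerivAt (fun s => γ s i) (γ' i) t)
    (P : MvPolynomial σ 𝕜) :
    HasDerivAt (fun s => eval (γ s) P) (∑ i, γ' i * eval (γ t) (pderiv i P)) t := by
  classical
  induction P using MvPolynomial.induction_on with
  | C a => simpa using hasDerivAt_const t a
  | add p q hp hq =>
    simp only [map_add, mul_add, Finset.sum_add_distrib]
    exact hp.add hq
  | mul_X p j hp =>
    simp only [map_mul, eval_X]
    refine (hp.mul (h j)).congr_deriv ?_
    have h_single : ∑ i, γ' i * (eval (γ t) p * eval (γ t) (pderiv i (X j))) =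
        eval (γ t) p * γ' j := by
      simp [pderiv_X, Pi.single_apply, apply_ite, mul_comm]
    simp only [pderiv_mul, map_add, map_mul, eval_X, mul_add, Finset.sum_add_distrib, h_single,
      Finset.sum_mul, mul_assoc]

theorem hasDerivAt_eval_add_smul_single {ι : Type*} [Finite ι] [DecidableEq ι]
    (P : MvPolynomial ι ℝ) (i : ι) (x : EuclideanSpace ℝ ι) (r : ℝ) :
    HasDerivAt (fun s : ℝ => eval (x + s • EuclideanSpace.single i (1 : ℝ)).ofLp P)
      (eval (x + r • EuclideanSpace.single i (1 : ℝ)).ofLp (pderiv i P)) r := by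
  cases nonempty_fintype ι
  have h_line (j : ι) : HasDerivAt (fun s : ℝ => (x + s • EuclideanSpace.single i (1 : ℝ)).ofLp j)
      ((Pi.single i 1 : ι → ℝ) j) r := by
    simpa [Pi.single_apply] using
      ((hasDerivAt_id r).mul_const (if j = i then (1 : ℝ) else 0)).const_add (x j)
  simpa [Pi.single_apply, ite_mul] using hasDerivAt_eval h_line P

section HarmonicPolynomial

variable {ι : Type*} [Fintype ι]

/-- The Laplace operator on polynomials in the variables `ι`. -/
def polyLaplacian (ι : Type*) [Fintype ι] : MvPolynomial ι ℝ →ₗ[ℝ] MvPolynomial ι ℝ :=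
  ∑ i : ι, (pderiv i).toLinearMap ∘ₗ (pderiv i).toLinearMap

/-- The space of harmonic polynomials in the variables `ι`. -/
def harmonicPoly (ι : Type*) [Fintype ι] : Submodule ℝ (MvPolynomial ι ℝ) :=
  LinearMap.ker (polyLaplacian ι)

/-- The Euler operator `∑ Xᵢ ∂ᵢ`, which multiplies homogeneous polynomials by their degree. -/
def eulerOp (ι : Type*) [Fintype ι] : MvPolynomial ι ℝ →ₗ[ℝ] MvPolynomial ι ℝ :=
  ∑ i : ι, LinearMap.mulLeft ℝ (X i) ∘ₗ (pderiv i).toLinearMap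

theorem mem_harmonicPoly {P : MvPolynomial ι ℝ} :
    P ∈ harmonicPoly ι ↔ ∑ i, pderiv i (pderiv i P) = 0 := by
  simp [harmonicPoly, polyLaplacian, LinearMap.sum_apply]

theorem eulerOp_apply (P : MvPolynomial ι ℝ) : eulerOp ι P = ∑ i, X i * pderiv i P := by
  simp [eulerOp, LinearMap.sum_apply]

theorem eulerOp_of_isHomogeneous {k : ℕ} {P : MvPolynomial ι ℝ} (hP : P.IsHomogeneous k) :
    eulerOp ι P = (k : ℝ) • P := by
  rw [eulerOp_apply, hP.sum_X_mul_pderiv, Nat.cast_smul_eq_nsmul]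

theorem homogeneousComponent_mem_harmonicPoly {P : MvPolynomial ι ℝ} (hP : P ∈ harmonicPoly ι)
    (n : ℕ) : homogeneousComponent n P ∈ harmonicPoly ι := by
  classical
  rw [mem_harmonicPoly] at *
  ext m
  have hm := congrArg (coeff m) hP
  simp only [coeff_sum, coeff_pderiv, coeff_homogeneousComponent, map_add, Finsupp.degree_single,
    coeff_zero] at hm ⊢
  split_ifs
  · exact hm
  · simp

theorem harmonicPoly_induction {motive : (P : MvPolynomial ι ℝ) → P ∈ harmonicPoly ι → Prop}
    (zero : motive 0 (zero_mem _))
    (add : ∀ A B hA hB, motive A hA → motive B hB → motive (A + B) (add_mem hA hB))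
    (homogeneous : ∀ k H hH, H.IsHomogeneous k → motive H hH)
    {P : MvPolynomial ι ℝ} (hP : P ∈ harmonicPoly ι) : motive P hP := by
  suffices ∃ h, motive (∑ k ∈ Finset.range (P.totalDegree + 1), homogeneousComponent k P) h by
    simpa only [sum_homogeneousComponent, hP, exists_true_left] using this
  exact Finset.sum_induction _ (fun A => ∃ h, motive A h)
    (fun A B ⟨hA, hA'⟩ ⟨hB, hB'⟩ => ⟨add_mem hA hB, add A B hA hB hA' hB'⟩) ⟨zero_mem _, zero⟩
    fun k _ => ⟨homogeneousComponent_mem_harmonicPoly hP k,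
      homogeneous k _ _ (homogeneousComponent_isHomogeneous k P)⟩

/-! ### Integrals over the unit sphere and Gaussian integrals -/

section PolarCoordinates

variable {E : Type*} [NormedAddCommGroup E] [NormedSpace ℝ E] [Nontrivial E]
  [FiniteDimensional ℝ E] [MeasurableSpace E] [BorelSpace E]

theorem integral_mul_fun_norm_of_homogeneous (μ : Measure E) [μ.IsAddHaarMeasure] {f : E → ℝ}
    {k : ℕ} (hf : ∀ (r : ℝ) (x : E), f (r • x) = r ^ k * f x) (g : ℝ → ℝ) :
    ∫ x, f x * g ‖x‖ ∂μ = (∫ ξ : Metric.sphere (0 : E) 1, f ξ ∂μ.toSphere) *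
      ∫ r in Set.Ioi (0 : ℝ), r ^ (Module.finrank ℝ E - 1 + k) * g r := by
  calc ∫ x, f x * g ‖x‖ ∂μ
      = ∫ x : ({0}ᶜ : Set E), f x.1 * g ‖x.1‖ ∂(μ.comap (↑)) := by
        rw [integral_subtype_comap (measurableSet_singleton _).compl fun x => f x * g ‖x‖,
          restrict_compl_singleton]
    _ = ∫ p, f p.1 * (p.2.1 ^ k * g p.2)
          ∂(μ.toSphere.prod (.volumeIoiPow (Module.finrank ℝ E - 1))) := by
        rw [← μ.measurePreserving_homeomorphUnitSphereProd.integral_comp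
          (Homeomorph.measurableEmbedding _)]
        refine integral_congr_ae (.of_forall fun x => ?_)
        have hx : ‖x.1‖ ≠ 0 := norm_ne_zero_iff.2 x.2
        simp only [homeomorphUnitSphereProd_apply_fst_coe, homeomorphUnitSphereProd_apply_snd_coe,
          hf, inv_pow]
        field_simp
    _ = (∫ ξ : Metric.sphere (0 : E) 1, f ξ ∂μ.toSphere) * ∫ r : Set.Ioi (0 : ℝ),
          r.1 ^ k * g r ∂(Measure.volumeIoiPow (Module.finrank ℝ E - 1)) :=
        integral_prod_mul (fun ξ : Metric.sphere (0 : E) 1 => f ξ)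
          fun r : Set.Ioi (0 : ℝ) => r.1 ^ k * g r
    _ = _ := by
        congr 1
        simp only [Measure.volumeIoiPow, ENNReal.ofReal]
        rw [integral_withDensity_eq_integral_smul (by fun_prop), integral_subtype_comap
          measurableSet_Ioi fun r => Real.toNNReal (r ^ (Module.finrank ℝ E - 1)) • (r ^ k * g r)]
        refine setIntegral_congr_fun measurableSet_Ioi fun r hr => ?_
        simp only [NNReal.smul_def, Real.coe_toNNReal _ (pow_nonneg (Set.mem_Ioi.1 hr).le _),
          smul_eq_mul, pow_add, mul_assoc]

end PolarCoordinates

theorem integrable_eval_mul_gaussian (P : MvPolynomial ι ℝ) :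
    Integrable fun x : EuclideanSpace ℝ ι => eval x.ofLp P * Real.exp (-(1 / 2) * ‖x‖ ^ 2) := by
  induction P using MvPolynomial.induction_on' with
  | add p q hp hq =>
    exact (hp.add hq).congr (.of_forall fun x => by simp only [Pi.add_apply, map_add, add_mul])
  | monomial m c =>
    have h_one (k : ℕ) : Integrable fun x : ℝ => x ^ k * Real.exp (-(1 / 2) * x ^ 2) := by
      simpa only [Real.rpow_natCast] using
        integrable_rpow_mul_exp_neg_mul_sq (b := 1 / 2) (by norm_num)
          (s := (k : ℝ)) (neg_one_lt_zero.trans_le k.cast_nonneg)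
    have h_prod : Integrable fun x : ι → ℝ => ∏ i, (x i ^ m i * Real.exp (-(1 / 2) * x i ^ 2)) :=
      Integrable.fintype_prod (f := fun i x => x ^ m i * Real.exp (-(1 / 2) * x ^ 2))
        fun i => h_one (m i)
    have h_euclidean :=
      ((EuclideanSpace.volume_preserving_symm_measurableEquiv_toLp ι).integrable_comp_emb
        (MeasurableEquiv.measurableEmbedding _)).2 h_prod
    refine (h_euclidean.const_mul c).congr (.of_forall fun x => ?_)
    simp only [eval_monomial, Finsupp.prod_fintype _ _ (fun _ => pow_zero _),
      EuclideanSpace.real_norm_sq_eq, Finset.mul_sum, Real.exp_sum, Function.comp_apply,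
      Finset.prod_mul_distrib, mul_assoc]
    rfl

/-- The integral `∫ P(x) exp(-‖x‖² / 2) dx`, as a linear functional of the polynomial `P`. -/
def gaussianIntegral (ι : Type*) [Fintype ι] : MvPolynomial ι ℝ →ₗ[ℝ] ℝ where
  toFun P := ∫ x : EuclideanSpace ℝ ι, eval x.ofLp P * Real.exp (-(1 / 2) * ‖x‖ ^ 2)
  map_add' P Q := by
    simp only [map_add, add_mul]
    exact integral_add (integrable_eval_mul_gaussian P) (integrable_eval_mul_gaussian Q)
  map_smul' c P := by
    simp only [smul_eval, RingHom.id_apply, smul_eq_mul, ← integral_const_mul, mul_assoc]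

/-- The integral of a polynomial over the unit sphere of `EuclideanSpace ℝ ι`, as a linear
functional. -/
def sphereIntegral (ι : Type*) [Fintype ι] : MvPolynomial ι ℝ →ₗ[ℝ] ℝ where
  toFun P := ∫ ξ : Metric.sphere (0 : EuclideanSpace ℝ ι) 1, eval ξ.1.ofLp P ∂volume.toSphere
  map_add' P Q := by
    have h_int (R : MvPolynomial ι ℝ) : Integrable
        (fun ξ : Metric.sphere (0 : EuclideanSpace ℝ ι) 1 => eval ξ.1.ofLp R) volume.toSphere :=
      (R.continuous_eval.comp (by fun_prop)).integrable_of_hasCompactSupport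
        (HasCompactSupport.of_compactSpace _)
    simp only [map_add, integral_add (h_int P) (h_int Q)]
  map_smul' c P := by simp only [smul_eval, integral_const_mul, RingHom.id_apply, smul_eq_mul]

theorem sphereIntegral_apply (P : MvPolynomial ι ℝ) : sphereIntegral ι P =
    ∫ ξ : Metric.sphere (0 : EuclideanSpace ℝ ι) 1, eval ξ.1.ofLp P ∂volume.toSphere := rfl

theorem hasLineDerivAt_exp_neg_norm_sq [DecidableEq ι] (i : ι) (x : EuclideanSpace ℝ ι) :
    HasLineDerivAt ℝ (fun y : EuclideanSpace ℝ ι => Real.exp (-(1 / 2) * ‖y‖ ^ 2))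
      (-(x i * Real.exp (-(1 / 2) * ‖x‖ ^ 2))) x (EuclideanSpace.single i 1) := by
  have h := (((hasStrictFDerivAt_norm_sq x).hasFDerivAt.const_mul (-(1 / 2))).exp).hasLineDerivAt
    (EuclideanSpace.single i 1)
  refine HasDerivAt.congr_deriv h ?_
  simp only [one_div, neg_mul, neg_smul, smul_neg, neg_apply, smul_apply, coe_innerSL_apply,
    EuclideanSpace.inner_single_right, Real.ringHom_apply, one_mul, nsmul_eq_mul, Nat.cast_ofNat,
    smul_eq_mul, ne_eq, OfNat.ofNat_ne_zero, not_false_eq_true, inv_mul_cancel_left₀, neg_inj]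
  ring

theorem gaussianIntegral_X_mul (i : ι) (P : MvPolynomial ι ℝ) :
    gaussianIntegral ι (X i * P) = gaussianIntegral ι (pderiv i P) := by
  classical
  have h_int := integrable_eval_mul_gaussian (X i * P)
  have h := integral_bilinear_hasLineDerivAt_right_eq_neg_left_of_integrable
    (B := ContinuousLinearMap.mul ℝ ℝ) (v := EuclideanSpace.single i (1 : ℝ))
    (μ := (volume : Measure (EuclideanSpace ℝ ι)))
    (integrable_eval_mul_gaussian (pderiv i P))
    (h_int.neg.congr (.of_forall fun x => by simp; ring))
    (integrable_eval_mul_gaussian P)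
    (fun x _ => (hasDerivAt_eval_add_smul_single P i x 0).congr_deriv (by simp))
    (fun x _ => hasLineDerivAt_exp_neg_norm_sq i x)
  simp only [ContinuousLinearMap.mul_apply', mul_neg, integral_neg, neg_inj] at h
  refine Eq.trans ?_ h
  refine integral_congr_ae (.of_forall fun x => ?_)
  simp only [map_mul, eval_X]
  ring

theorem gaussianIntegral_mul_eulerOp (P : MvPolynomial ι ℝ) {Q : MvPolynomial ι ℝ}
    (hQ : Q ∈ harmonicPoly ι) :
    gaussianIntegral ι (P * eulerOp ι Q) =
      gaussianIntegral ι (∑ i, pderiv i P * pderiv i Q) := by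
  have h_byParts (i : ι) : gaussianIntegral ι (P * (X i * pderiv i Q)) =
      gaussianIntegral ι (pderiv i P * pderiv i Q) +
        gaussianIntegral ι (P * pderiv i (pderiv i Q)) := by
    rw [mul_left_comm, gaussianIntegral_X_mul, pderiv_mul, map_add]
  rw [eulerOp_apply, Finset.mul_sum, map_sum]
  simp only [h_byParts, Finset.sum_add_distrib, ← map_sum, ← Finset.mul_sum,
    mem_harmonicPoly.1 hQ, mul_zero, map_zero, add_zero]

theorem gaussianIntegral_mul_eq_zero {j k : ℕ} (hjk : j ≠ k) {P Q : MvPolynomial ι ℝ}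
    (hP : P ∈ harmonicPoly ι) (hPj : P.IsHomogeneous j)
    (hQ : Q ∈ harmonicPoly ι) (hQk : Q.IsHomogeneous k) : gaussianIntegral ι (P * Q) = 0 := by
  have h : gaussianIntegral ι (P * eulerOp ι Q) = gaussianIntegral ι (Q * eulerOp ι P) := by
    rw [gaussianIntegral_mul_eulerOp P hQ, gaussianIntegral_mul_eulerOp Q hP]
    simp only [mul_comm]
  rw [eulerOp_of_isHomogeneous hPj, eulerOp_of_isHomogeneous hQk, mul_smul_comm, mul_smul_comm,
    map_smul, map_smul, mul_comm Q, smul_eq_mul, smul_eq_mul] at h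
  exact (mul_eq_mul_right_iff.1 h).resolve_left fun e => hjk (Nat.cast_injective e).symm

theorem gaussianIntegral_eq_zero_iff_sphereIntegral [Nonempty ι] {k : ℕ} {P : MvPolynomial ι ℝ}
    (hP : P.IsHomogeneous k) : gaussianIntegral ι P = 0 ↔ sphereIntegral ι P = 0 := by
  let N := Module.finrank ℝ (EuclideanSpace ℝ ι) - 1 + k
  have h_polar : gaussianIntegral ι P = sphereIntegral ι P *
      ∫ r in Set.Ioi (0 : ℝ), r ^ N * Real.exp (-(1 / 2) * r ^ 2) :=
    integral_mul_fun_norm_of_homogeneous volume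
      (f := fun x : EuclideanSpace ℝ ι => eval x.ofLp P)
      (fun r x => eval_smul_of_isHomogeneous hP r x.ofLp) fun r => Real.exp (-(1 / 2) * r ^ 2)
  have h_radial : 0 < ∫ r in Set.Ioi (0 : ℝ), r ^ N * Real.exp (-(1 / 2) * r ^ 2) := by
    have hN : -1 < (N : ℝ) := neg_one_lt_zero.trans_le N.cast_nonneg
    have h := integral_rpow_mul_exp_neg_mul_rpow (p := 2) two_pos hN (b := 1 / 2) (by norm_num)
    simp only [Real.rpow_natCast, Real.rpow_two] at h
    rw [h]
    have := Real.Gamma_pos_of_pos (show 0 < ((N : ℝ) + 1) / 2 by positivity)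
    positivity
  rw [h_polar, mul_eq_zero, or_iff_left h_radial.ne']

/-! ### Orthogonality of spherical harmonics -/

theorem sphereIntegral_mul_eq_zero [Nonempty ι] {j k : ℕ} (hjk : j ≠ k) {P Q : MvPolynomial ι ℝ}
    (hP : P ∈ harmonicPoly ι) (hPj : P.IsHomogeneous j)
    (hQ : Q ∈ harmonicPoly ι) (hQk : Q.IsHomogeneous k) : sphereIntegral ι (P * Q) = 0 :=
  (gaussianIntegral_eq_zero_iff_sphereIntegral (hPj.mul hQk)).1
    (gaussianIntegral_mul_eq_zero hjk hP hPj hQ hQk)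

theorem sphereIntegral_mul_of_isHomogeneous [Nonempty ι] {k : ℕ} {P H : MvPolynomial ι ℝ}
    (hP : P ∈ harmonicPoly ι) (hH : H ∈ harmonicPoly ι) (hHk : H.IsHomogeneous k) :
    sphereIntegral ι (P * H) = sphereIntegral ι (homogeneousComponent k P * H) := by
  induction hP using harmonicPoly_induction with
  | zero => simp
  | add A B _ _ hA hB => simp only [add_mul, map_add, hA, hB]
  | homogeneous j A hA hAj =>
    rw [homogeneousComponent_of_mem hAj]
    split_ifs with h
    · rfl
    · rw [sphereIntegral_mul_eq_zero (Ne.symm h) hA hAj hH hHk, zero_mul, map_zero]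

theorem sphereIntegral_mul_eq_zero_of_mem_polyLE [Nonempty ι] {n : ℕ} {P H : MvPolynomial ι ℝ}
    (hP : P ∈ harmonicPoly ι) (hPn : P ∈ polyLE ι ℝ (n - 1)) (hH : H ∈ harmonicPoly ι)
    (hHn : H.IsHomogeneous n) : sphereIntegral ι (P * H) = 0 := by
  have h : homogeneousComponent n P = 0 := by
    ext m
    rw [coeff_homogeneousComponent, coeff_zero, ite_eq_right_iff]
    intro hm
    by_contra h_ne
    have := mem_polyLE.1 hPn m h_ne
    omega
  rw [sphereIntegral_mul_of_isHomogeneous hP hH hHn, h, zero_mul, map_zero]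

theorem sphereIntegral_eulerOp_mul [Nonempty ι] {P Q : MvPolynomial ι ℝ}
    (hP : P ∈ harmonicPoly ι) (hQ : Q ∈ harmonicPoly ι) :
    sphereIntegral ι (eulerOp ι P * Q) = sphereIntegral ι (P * eulerOp ι Q) := by
  induction hP using harmonicPoly_induction with
  | zero => simp
  | add A B _ _ hA hB => simp only [add_mul, map_add, hA, hB]
  | homogeneous j A hA hAj =>
  induction hQ using harmonicPoly_induction with
  | zero => simp
  | add B C _ _ hB hC => simp only [mul_add, map_add, hB, hC]
  | homogeneous k B hB hBk =>
  rw [eulerOp_of_isHomogeneous hAj, eulerOp_of_isHomogeneous hBk, smul_mul_assoc, mul_smul_comm,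
    map_smul, map_smul]
  rcases eq_or_ne j k with rfl | hjk
  · rfl
  · rw [sphereIntegral_mul_eq_zero hjk hA hAj hB hBk, smul_zero, smul_zero]

theorem sphereIntegral_mul_self_nonneg (P : MvPolynomial ι ℝ) : 0 ≤ sphereIntegral ι (P * P) :=
  integral_nonneg fun ξ => by
    rw [map_mul]
    exact mul_self_nonneg _

theorem eval_eq_zero_of_sphereIntegral_mul_self {P : MvPolynomial ι ℝ}
    (h : sphereIntegral ι (P * P) = 0) (ξ : Metric.sphere (0 : EuclideanSpace ℝ ι) 1) :
    eval ξ.1.ofLp P = 0 := by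
  have h_cont : Continuous fun ξ : Metric.sphere (0 : EuclideanSpace ℝ ι) 1 =>
      eval ξ.1.ofLp (P * P) := (P * P).continuous_eval.comp (by fun_prop)
  by_contra hξ
  refine (h_cont.integral_pos_of_hasCompactSupport_nonneg_nonzero
    (μ := (volume : Measure (EuclideanSpace ℝ ι)).toSphere)
    (HasCompactSupport.of_compactSpace _) (fun η => ?_) (x := ξ) (by simpa using hξ)).ne' h
  rw [map_mul]
  exact mul_self_nonneg _

theorem eq_zero_of_isHomogeneous_of_eval_sphere [Nonempty ι] {k : ℕ} {P : MvPolynomial ι ℝ}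
    (hP : P.IsHomogeneous k)
    (h : ∀ ξ : Metric.sphere (0 : EuclideanSpace ℝ ι) 1, eval ξ.1.ofLp P = 0) : P = 0 := by
  obtain ⟨ξ₀⟩ : Nonempty (Metric.sphere (0 : EuclideanSpace ℝ ι) 1) :=
    (NormedSpace.sphere_nonempty.2 zero_le_one).to_subtype
  refine MvPolynomial.funext fun x => ?_
  obtain ⟨r, ξ, hξ⟩ : ∃ (r : ℝ) (ξ : Metric.sphere (0 : EuclideanSpace ℝ ι) 1),
      x = r • ξ.1.ofLp := by
    rcases eq_or_ne (WithLp.toLp 2 x : EuclideanSpace ℝ ι) 0 with hx | hx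
    · exact ⟨0, ξ₀, by simpa using hx⟩
    · refine ⟨‖(WithLp.toLp 2 x : EuclideanSpace ℝ ι)‖,
        ⟨‖(WithLp.toLp 2 x : EuclideanSpace ℝ ι)‖⁻¹ • WithLp.toLp 2 x, ?_⟩, ?_⟩
      · simp [norm_smul, inv_mul_cancel₀ (norm_ne_zero_iff.2 hx)]
      · simp [smul_smul, mul_inv_cancel₀ (norm_ne_zero_iff.2 hx)]
  rw [hξ, eval_smul_of_isHomogeneous hP, h, mul_zero, map_zero]

theorem eq_zero_of_harmonicPoly_of_sphereIntegral [Nonempty ι] {P : MvPolynomial ι ℝ}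
    (hP : P ∈ harmonicPoly ι) (h : sphereIntegral ι (P * P) = 0) : P = 0 := by
  rw [← sum_homogeneousComponent P]
  refine Finset.sum_eq_zero fun k _ =>
    eq_zero_of_isHomogeneous_of_eval_sphere (homogeneousComponent_isHomogeneous k P)
      (eval_eq_zero_of_sphereIntegral_mul_self ?_)
  rw [← sphereIntegral_mul_of_isHomogeneous hP (homogeneousComponent_mem_harmonicPoly hP k)
    (homogeneousComponent_isHomogeneous k P), sphereIntegral_apply]
  simp only [map_mul, eval_eq_zero_of_sphereIntegral_mul_self h, zero_mul, integral_zero]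

theorem isHomogeneous_of_sphereIntegral_mul_eq_zero [Nonempty ι] {n : ℕ} {P : MvPolynomial ι ℝ}
    (hP : P ∈ harmonicPoly ι) (hPn : P ∈ polyLE ι ℝ n)
    (h : ∀ Q ∈ harmonicPoly ι, Q ∈ polyLE ι ℝ (n - 1) → sphereIntegral ι (P * Q) = 0) :
    P.IsHomogeneous n := by
  suffices ∀ k ≠ n, homogeneousComponent k P = 0 by
    rw [← sum_homogeneousComponent P]
    refine IsHomogeneous.sum _ _ _ fun k _ => ?_
    rcases eq_or_ne k n with rfl | hk
    · exact homogeneousComponent_isHomogeneous k P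
    · rw [this k hk]
      exact isHomogeneous_zero _ _ _
  intro k hk
  rcases lt_or_gt_of_ne hk with hk | hk
  · have hPk := homogeneousComponent_mem_harmonicPoly hP k
    refine eq_zero_of_harmonicPoly_of_sphereIntegral hPk ?_
    rw [← sphereIntegral_mul_of_isHomogeneous hP hPk (homogeneousComponent_isHomogeneous k P)]
    exact h _ hPk (polyLE_mono (by omega)
      (mem_polyLE_natCast.2 (homogeneousComponent_isHomogeneous k P).totalDegree_le))
  · exact homogeneousComponent_eq_zero _ _ ((mem_polyLE_natCast.1 hPn).trans_lt hk)

end HarmonicPolynomial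

/-! ### The Laplace–Beltrami operator on harmonic polynomials -/

section LaplaceBeltrami

theorem iteratedFDeriv_two_apply_eq_of_hasDerivAt {E F : Type*} [NormedAddCommGroup E]
    [NormedSpace ℝ E] [NormedAddCommGroup F] [NormedSpace ℝ F] {G : E → F} {x v : E}
    (hG : ContDiffAt ℝ 2 G x) {g : ℝ → F} {c : F}
    (hg : ∀ᶠ s in nhds (0 : ℝ), HasDerivAt (fun r : ℝ => G (x + r • v)) (g s) s)
    (hc : HasDerivAt g c 0) : iteratedFDeriv ℝ 2 G x ![v, v] = c := by
  have h_line (s : ℝ) : HasDerivAt (fun r : ℝ => x + r • v) v s := by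
    simpa using ((hasDerivAt_id s).smul_const v).const_add x
  have h_zero : x + (0 : ℝ) • v = x := by simp
  have h_tendsto : Filter.Tendsto (fun r : ℝ => x + r • v) (nhds 0) (nhds x) := by
    simpa only [h_zero] using (h_line 0).continuousAt.tendsto
  have h_diff : ∀ᶠ y in nhds x, DifferentiableAt ℝ G y :=
    (hG.eventually (by simp)).mono fun y hy => hy.differentiableAt (by norm_num)
  have hg_eq : g =ᶠ[nhds 0] fun s => fderiv ℝ G (x + s • v) v := by
    filter_upwards [hg, h_tendsto.eventually h_diff] with s hs hs'
    exact hs.unique (hs'.hasFDerivAt.comp_hasDerivAt s (h_line s))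
  have hG' : HasFDerivAt (fderiv ℝ G) (fderiv ℝ (fderiv ℝ G) x) (x + (0 : ℝ) • v) := by
    rw [h_zero]
    exact ((hG.fderiv_right (m := 1) (by norm_num)).differentiableAt (by norm_num)).hasFDerivAt
  have h_second : HasDerivAt (fun s : ℝ => fderiv ℝ G (x + s • v) v)
      (fderiv ℝ (fderiv ℝ G) x v v) 0 :=
    (ContinuousLinearMap.apply ℝ F v).hasFDerivAt.comp_hasDerivAt 0
      (hG'.comp_hasDerivAt 0 (h_line 0))
  rw [iteratedFDeriv_two_apply]
  exact (h_second.congr_of_eventuallyEq hg_eq).unique hc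

theorem hasDerivAt_inv_norm_add_smul_single {ι : Type*} [Fintype ι] [DecidableEq ι]
    (x : EuclideanSpace ℝ ι) (i : ι) {s : ℝ}
    (hs : x + s • EuclideanSpace.single i (1 : ℝ) ≠ 0) :
    HasDerivAt (fun r : ℝ => ‖x + r • EuclideanSpace.single i (1 : ℝ)‖⁻¹)
      (-(‖x + s • EuclideanSpace.single i (1 : ℝ)‖⁻¹ ^ 3 * (x i + s))) s := by
  have h_line : HasDerivAt (fun r : ℝ => x + r • EuclideanSpace.single i (1 : ℝ))
      (EuclideanSpace.single i (1 : ℝ)) s := by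
    simpa using ((hasDerivAt_id s).smul_const (EuclideanSpace.single i (1 : ℝ))).const_add x
  have h_sqrt := h_line.norm_sq.sqrt (by simpa using hs)
  simp only [Real.sqrt_sq (norm_nonneg _)] at h_sqrt
  refine (h_sqrt.inv (norm_ne_zero_iff.2 hs)).congr_deriv ?_
  rw [EuclideanSpace.inner_single_right]
  have := norm_ne_zero_iff.2 hs
  simp only [PiLp.add_apply, PiLp.smul_apply, PiLp.single_eq_same, smul_eq_mul, mul_one,
    Real.ringHom_apply, one_mul, inv_pow]
  field_simp

variable {d : ℕ}

theorem radialExtension_eval (P : MvPolynomial (Fin d) ℝ) {y : EuclideanSpace ℝ (Fin d)}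
    (hy : y ≠ 0) : radialExtension (fun η => eval η.1.ofLp P) y = eval (‖y‖⁻¹ • y.ofLp) P := by
  rw [radialExtension, dif_neg hy]
  rfl

theorem contDiffAt_radialExtension_eval (P : MvPolynomial (Fin d) ℝ)
    {x : EuclideanSpace ℝ (Fin d)} (hx : x ≠ 0) :
    ContDiffAt ℝ 2 (radialExtension fun η => eval η.1.ofLp P) x := by
  have h_eval (y : EuclideanSpace ℝ (Fin d)) :
      ContDiffAt ℝ 2 (fun y : EuclideanSpace ℝ (Fin d) => eval y.ofLp P) y :=
    (AnalyticOnNhd.eval_continuousLinearMap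
      (EuclideanSpace.equiv (Fin d) ℝ).toContinuousLinearMap P y trivial).contDiffAt
  have h_normalize : ContDiffAt ℝ 2 (fun y : EuclideanSpace ℝ (Fin d) => ‖y‖⁻¹ • y) x :=
    ((contDiffAt_norm ℝ hx).inv (norm_ne_zero_iff.2 hx)).smul contDiffAt_id
  refine ((h_eval _).comp x h_normalize).congr_of_eventuallyEq ?_
  filter_upwards [isOpen_ne.mem_nhds hx] with y hy
  exact radialExtension_eval P hy

theorem hasDerivAt_inv_norm_pow_mul_eval (P : MvPolynomial (Fin d) ℝ) (k : ℕ)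
    (x : EuclideanSpace ℝ (Fin d)) (i : Fin d) {s : ℝ}
    (hs : x + s • EuclideanSpace.single i (1 : ℝ) ≠ 0) :
    HasDerivAt (fun r : ℝ => ‖x + r • EuclideanSpace.single i (1 : ℝ)‖⁻¹ ^ k *
        eval (x + r • EuclideanSpace.single i (1 : ℝ)).ofLp P)
      (‖x + s • EuclideanSpace.single i (1 : ℝ)‖⁻¹ ^ k *
          eval (x + s • EuclideanSpace.single i (1 : ℝ)).ofLp (pderiv i P) -
        k * (x i + s) * (‖x + s • EuclideanSpace.single i (1 : ℝ)‖⁻¹ ^ (k + 2) *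
          eval (x + s • EuclideanSpace.single i (1 : ℝ)).ofLp P)) s := by
  refine (((hasDerivAt_inv_norm_add_smul_single x i hs).pow k).mul
    (hasDerivAt_eval_add_smul_single P i x s)).congr_deriv ?_
  rcases k with - | k
  · simp
  · rw [Nat.add_sub_cancel, Pi.pow_apply]
    ring

theorem iteratedFDeriv_two_radialExtension_eval {k : ℕ} {P : MvPolynomial (Fin d) ℝ}
    (hP : P.IsHomogeneous k) (ξ : UnitSphere d) (i : Fin d) :
    iteratedFDeriv ℝ 2 (radialExtension fun η => eval η.1.ofLp P) ξ.1
        ![EuclideanSpace.single i 1, EuclideanSpace.single i 1] =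
      eval ξ.1.ofLp (pderiv i (pderiv i P)) - 2 * k * (ξ.1 i * eval ξ.1.ofLp (pderiv i P)) +
        k * ((k + 2) * ξ.1 i ^ 2 - 1) * eval ξ.1.ofLp P := by
  have hξ : ‖ξ.1‖ = 1 := norm_eq_of_mem_sphere ξ
  have hξ₀ : ξ.1 ≠ 0 := ne_zero_of_mem_unit_sphere ξ
  have h_ne : ∀ᶠ s in nhds (0 : ℝ), ξ.1 + s • EuclideanSpace.single i (1 : ℝ) ≠ 0 :=
    (show Continuous fun s : ℝ => ξ.1 + s • EuclideanSpace.single i (1 : ℝ) by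
      fun_prop).continuousAt.eventually_ne (by simpa using hξ₀)
  refine iteratedFDeriv_two_apply_eq_of_hasDerivAt (contDiffAt_radialExtension_eval P hξ₀)
    (g := fun s => ‖ξ.1 + s • EuclideanSpace.single i (1 : ℝ)‖⁻¹ ^ k *
          eval (ξ.1 + s • EuclideanSpace.single i (1 : ℝ)).ofLp (pderiv i P) -
        k * (ξ.1 i + s) * (‖ξ.1 + s • EuclideanSpace.single i (1 : ℝ)‖⁻¹ ^ (k + 2) *
          eval (ξ.1 + s • EuclideanSpace.single i (1 : ℝ)).ofLp P)) ?_ ?_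
  · filter_upwards [h_ne.eventually_nhds] with s hs
    refine (hasDerivAt_inv_norm_pow_mul_eval P k ξ.1 i hs.self_of_nhds).congr_of_eventuallyEq ?_
    filter_upwards [hs] with r hr
    rw [radialExtension_eval P hr, ← eval_smul_of_isHomogeneous hP]
  · have h₀ : ξ.1 + (0 : ℝ) • EuclideanSpace.single i (1 : ℝ) ≠ 0 := by simpa using hξ₀
    refine ((hasDerivAt_inv_norm_pow_mul_eval (pderiv i P) k ξ.1 i h₀).sub
      ((((hasDerivAt_id (0 : ℝ)).const_add (ξ.1 i)).const_mul (k : ℝ)).mul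
        (hasDerivAt_inv_norm_pow_mul_eval P (k + 2) ξ.1 i h₀))).congr_deriv ?_
    simp only [zero_smul, add_zero, hξ, inv_one, one_pow, one_mul, id_eq, Nat.cast_add,
      Nat.cast_ofNat]
    ring

theorem laplaceBeltrami_eval_of_isHomogeneous {k : ℕ} {P : MvPolynomial (Fin d) ℝ}
    (hP : P ∈ harmonicPoly (Fin d)) (hPk : P.IsHomogeneous k) (ξ : UnitSphere d) :
    laplaceBeltrami (fun η => eval η.1.ofLp P) ξ = -(k * (k + d - 2)) * eval ξ.1.ofLp P := by
  have h_sphere : ∑ i, ξ.1 i ^ 2 = 1 := by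
    rw [← EuclideanSpace.real_norm_sq_eq, norm_eq_of_mem_sphere ξ, one_pow]
  have h_harmonic : ∑ i, eval ξ.1.ofLp (pderiv i (pderiv i P)) = 0 := by
    rw [← map_sum, mem_harmonicPoly.1 hP, map_zero]
  have h_euler : ∑ i, ξ.1 i * eval ξ.1.ofLp (pderiv i P) = k * eval ξ.1.ofLp P := by
    rw [← smul_eval, ← eulerOp_of_isHomogeneous hPk, eulerOp_apply]
    simp only [map_sum, map_mul, eval_X]
  rw [laplaceBeltrami, InnerProductSpace.laplacian_eq_iteratedFDeriv_orthonormalBasis _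
    (EuclideanSpace.basisFun (Fin d) ℝ)]
  simp only [EuclideanSpace.basisFun_apply, iteratedFDeriv_two_radialExtension_eval hPk,
    Finset.sum_add_distrib, Finset.sum_sub_distrib, ← Finset.mul_sum, ← Finset.sum_mul,
    h_harmonic, h_euler, h_sphere, Finset.sum_const, Finset.card_univ, Fintype.card_fin,
    nsmul_eq_mul]
  ring

theorem laplaceBeltrami_eval_add (P Q : MvPolynomial (Fin d) ℝ) (ξ : UnitSphere d) :
    laplaceBeltrami (fun η => eval η.1.ofLp (P + Q)) ξ =
      laplaceBeltrami (fun η => eval η.1.ofLp P) ξ +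
        laplaceBeltrami (fun η => eval η.1.ofLp Q) ξ := by
  have hξ : ξ.1 ≠ 0 := ne_zero_of_mem_unit_sphere ξ
  have h_add : (radialExtension fun η : UnitSphere d => eval η.1.ofLp (P + Q)) =
      (radialExtension fun η => eval η.1.ofLp P) + radialExtension fun η => eval η.1.ofLp Q := by
    funext y
    by_cases hy : y = 0 <;> simp [radialExtension, hy]
  rw [laplaceBeltrami, h_add, (contDiffAt_radialExtension_eval P hξ).laplacian_add
    (contDiffAt_radialExtension_eval Q hξ)]
  rfl

theorem laplaceBeltrami_eval {P : MvPolynomial (Fin d) ℝ} (hP : P ∈ harmonicPoly (Fin d))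
    (ξ : UnitSphere d) :
    laplaceBeltrami (fun η => eval η.1.ofLp P) ξ =
      -eval ξ.1.ofLp (eulerOp (Fin d) (eulerOp (Fin d) P) + ((d : ℝ) - 2) • eulerOp (Fin d) P) := by
  induction hP using harmonicPoly_induction with
  | zero =>
    simpa using laplaceBeltrami_eval_of_isHomogeneous (zero_mem _) (isHomogeneous_zero _ _ 0) ξ
  | add A B _ _ hA hB =>
    rw [laplaceBeltrami_eval_add, hA, hB]
    simp only [map_add, smul_eval]
    ring
  | homogeneous k H hH hHk =>
    rw [laplaceBeltrami_eval_of_isHomogeneous hH hHk]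
    simp only [eulerOp_of_isHomogeneous hHk, map_smul, map_add, smul_eval]
    ring

end LaplaceBeltrami

/-! ### Slices of the cone -/

theorem aeval_mem_polyLE {σ τ R : Type*} [CommSemiring R] {f : σ → MvPolynomial τ R}
    (hf : ∀ i, (f i).totalDegree ≤ 1) {n : ℤ} {P : MvPolynomial σ R} (hP : P ∈ polyLE σ R n) :
    aeval f P ∈ polyLE τ R n := by
  rw [polyLE, restrictSupport_eq_span] at hP
  induction hP using Submodule.span_induction with
  | zero => rw [map_zero]; exact zero_mem _
  | add p q _ _ hp hq => rw [map_add]; exact add_mem hp hq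
  | smul c p _ hp => rw [map_smul]; exact Submodule.smul_mem _ _ hp
  | mem p hp =>
    obtain ⟨m, hm, rfl⟩ := hp
    refine polyLE_mono hm (mem_polyLE_natCast.2 ?_)
    rw [aeval_monomial, map_one, one_mul]
    refine (totalDegree_finsetProd _ _).trans (Finset.sum_le_sum fun i _ => ?_)
    exact (totalDegree_pow _ _).trans ((Nat.mul_le_mul_left _ (hf i)).trans (mul_one _).le)

section Slice

variable {d : ℕ}

theorem mem_xHarmonic {P : MvPolynomial (Fin (d + 1)) ℝ} :
    P ∈ xHarmonic d ↔ ∑ i : Fin d, pderiv i.castSucc (pderiv i.castSucc P) = 0 := by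
  rw [xHarmonic, LinearMap.mem_ker, xLaplacian_apply]

theorem rename_mem_xHarmonic {Y : MvPolynomial (Fin d) ℝ} (hY : Y ∈ harmonicPoly (Fin d)) :
    rename Fin.castSucc Y ∈ xHarmonic d := by
  simp only [mem_xHarmonic, pderiv_rename (Fin.castSucc_injective d), ← map_sum,
    mem_harmonicPoly.1 hY, map_zero]

theorem pderiv_last_rename (Y : MvPolynomial (Fin d) ℝ) :
    pderiv (Fin.last d) (rename Fin.castSucc Y) = 0 := by
  classical
  refine pderiv_eq_zero_of_notMem_vars fun h => ?_
  obtain ⟨i, -, hi⟩ := Finset.mem_image.1 (vars_rename _ _ h)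
  exact (Fin.castSucc_lt_last i).ne hi

/-- The substitution `(x, t) = (s ξ, s)`, which restricts a polynomial to the slice `t = s` of the
cone, as a polynomial in `ξ`. -/
def coneSlice (d : ℕ) (s : ℝ) : MvPolynomial (Fin (d + 1)) ℝ →ₐ[ℝ] MvPolynomial (Fin d) ℝ :=
  aeval (s • Fin.snoc (α := fun _ => MvPolynomial (Fin d) ℝ) X 1)

theorem coneSlice_X_castSucc (s : ℝ) (i : Fin d) :
    coneSlice d s (X i.castSucc) = C s * X i := by
  rw [coneSlice, aeval_X, Pi.smul_apply, Fin.snoc_castSucc, smul_eq_C_mul]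

theorem coneSlice_X_last (s : ℝ) : coneSlice d s (X (Fin.last d)) = C s := by
  rw [coneSlice, aeval_X, Pi.smul_apply, Fin.snoc_last, smul_eq_C_mul, mul_one]

theorem coneSlice_of_isHomogeneous {k : ℕ} {P : MvPolynomial (Fin (d + 1)) ℝ}
    (hP : P.IsHomogeneous k) (s : ℝ) : coneSlice d s P = s ^ k • coneSlice d 1 P := by
  rw [coneSlice, coneSlice, aeval_smul_of_isHomogeneous hP, one_smul]

theorem coneSlice_one_one_sub_X_last_mul (P : MvPolynomial (Fin (d + 1)) ℝ) :
    coneSlice d 1 ((1 - X (Fin.last d)) * P) = 0 := by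
  rw [map_mul, map_sub, map_one, coneSlice_X_last, map_one, sub_self, zero_mul]

theorem coneSlice_one_rename (Y : MvPolynomial (Fin d) ℝ) :
    coneSlice d 1 (rename Fin.castSucc Y) = Y := by
  refine DFunLike.congr_fun (?_ : (coneSlice d 1).comp (rename Fin.castSucc) = AlgHom.id ℝ _) Y
  ext1 i
  simp only [AlgHom.comp_apply, rename_X, coneSlice_X_castSucc, map_one, one_mul, AlgHom.id_apply]

theorem one_sub_X_last_dvd_sub_rename_coneSlice_one (P : MvPolynomial (Fin (d + 1)) ℝ) :
    1 - X (Fin.last d) ∣ P - rename Fin.castSucc (coneSlice d 1 P) := by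
  rw [← Ideal.mem_span_singleton, ← Ideal.Quotient.eq]
  let π := Ideal.Quotient.mkₐ ℝ
    (Ideal.span {(1 - X (Fin.last d) : MvPolynomial (Fin (d + 1)) ℝ)})
  refine DFunLike.congr_fun (?_ : π = (π.comp (rename Fin.castSucc)).comp (coneSlice d 1)) P
  ext1 i
  refine Fin.lastCases ?_ (fun j => ?_) i
  · rw [AlgHom.comp_apply, coneSlice_X_last, map_one, map_one, ← sub_eq_zero, ← neg_eq_zero,
      neg_sub, ← map_one π, ← map_sub]
    exact Ideal.Quotient.eq_zero_iff_mem.2 (Ideal.mem_span_singleton_self _)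
  · simp only [AlgHom.comp_apply, coneSlice_X_castSucc, map_one, one_mul, rename_X]

theorem eval_coneSlice (s : ℝ) (P : MvPolynomial (Fin (d + 1)) ℝ) (x : Fin d → ℝ) :
    eval x (coneSlice d s P) = eval (Fin.snoc (α := fun _ => ℝ) (fun i => s * x i) s) P := by
  simp only [← aeval_eq_eval]
  refine DFunLike.congr_fun (?_ : (aeval (R := ℝ) x).comp (coneSlice d s) = aeval _) P
  ext i
  refine Fin.lastCases ?_ (fun j => ?_) i
  · rw [AlgHom.comp_apply, coneSlice_X_last, aeval_X, Fin.snoc_last, aeval_C,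
      Algebra.algebraMap_self_apply]
  · rw [AlgHom.comp_apply, coneSlice_X_castSucc, aeval_X, Fin.snoc_castSucc, map_mul, aeval_C,
      aeval_X, Algebra.algebraMap_self_apply]

theorem pderiv_coneSlice (s : ℝ) (i : Fin d) (P : MvPolynomial (Fin (d + 1)) ℝ) :
    pderiv i (coneSlice d s P) = s • coneSlice d s (pderiv i.castSucc P) := by
  simp only [smul_eq_C_mul]
  induction P using MvPolynomial.induction_on with
  | C a => rw [algHom_C, algebraMap_eq, pderiv_C, pderiv_C, map_zero, mul_zero]
  | add p q hp hq => simp only [map_add, hp, hq, mul_add]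
  | mul_X p j hp =>
    rw [map_mul, pderiv_mul, hp, pderiv_mul, map_add, map_mul, map_mul]
    refine Fin.lastCases ?_ (fun j => ?_) j
    · rw [coneSlice_X_last, pderiv_C, pderiv_X_of_ne (Fin.castSucc_lt_last _).ne', map_zero]
      ring
    · rw [coneSlice_X_castSucc, pderiv_C_mul]
      rcases eq_or_ne j i with rfl | h
      · rw [pderiv_X_self, pderiv_X_self, map_one]
        ring
      · rw [pderiv_X_of_ne h, pderiv_X_of_ne ((Fin.castSucc_injective d).ne h), map_zero]
        ring

theorem coneSlice_mem_harmonicPoly (s : ℝ) {P : MvPolynomial (Fin (d + 1)) ℝ}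
    (hP : P ∈ xHarmonic d) : coneSlice d s P ∈ harmonicPoly (Fin d) := by
  simp only [mem_harmonicPoly, pderiv_coneSlice, Derivation.map_smul, ← Finset.smul_sum,
    ← map_sum, mem_xHarmonic.1 hP, map_zero, smul_zero]

theorem eulerOp_coneSlice (s : ℝ) (P : MvPolynomial (Fin (d + 1)) ℝ) :
    eulerOp (Fin d) (coneSlice d s P) = coneSlice d s (xEuler d P) := by
  simp only [eulerOp_apply, pderiv_coneSlice, xEuler, map_sum, map_mul, coneSlice_X_castSucc]
  exact Finset.sum_congr rfl fun i _ => by rw [smul_eq_C_mul]; ring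

theorem coneSlice_mem_polyLE (s : ℝ) {n : ℤ} {P : MvPolynomial (Fin (d + 1)) ℝ}
    (hP : P ∈ polyLE (Fin (d + 1)) ℝ n) : coneSlice d s P ∈ polyLE (Fin d) ℝ n := by
  refine aeval_mem_polyLE (fun i => Fin.lastCases ?_ (fun j => ?_) i) hP
  · rw [Pi.smul_apply, Fin.snoc_last]
    exact (totalDegree_smul_le _ _).trans (totalDegree_one.trans_le zero_le_one)
  · rw [Pi.smul_apply, Fin.snoc_castSucc]
    exact (totalDegree_smul_le _ _).trans (totalDegree_X _).le

theorem rename_mem_polyLE {n : ℤ} {Y : MvPolynomial (Fin d) ℝ} (hY : Y ∈ polyLE (Fin d) ℝ n) :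
    rename Fin.castSucc Y ∈ polyLE (Fin (d + 1)) ℝ n := by
  rw [← aeval_X_left_apply (rename _ Y), aeval_rename]
  exact aeval_mem_polyLE (fun _ => (totalDegree_X _).le) hY

end Slice

/-! ### Operators that scale by the bidegree -/

section BidegreeScale

variable {d : ℕ}

/-- The degree in `x` of the monomial in `(x, t)` with exponent `m`. -/
def xDegree (m : Fin (d + 1) →₀ ℕ) : ℕ := ∑ i : Fin d, m i.castSucc

theorem degree_eq_xDegree_add (m : Fin (d + 1) →₀ ℕ) :
    m.degree = xDegree m + m (Fin.last d) := by
  rw [Finsupp.degree_eq_sum, Fin.sum_univ_castSucc, xDegree]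

theorem xDegree_add (m k : Fin (d + 1) →₀ ℕ) : xDegree (m + k) = xDegree m + xDegree k := by
  simp only [xDegree, Finsupp.add_apply, Finset.sum_add_distrib]

theorem xDegree_single_castSucc (i : Fin d) (k : ℕ) :
    xDegree (Finsupp.single i.castSucc k) = k := by
  classical
  simp [xDegree, Finsupp.single_apply]

theorem xDegree_single_last (k : ℕ) : xDegree (Finsupp.single (Fin.last d) k) = 0 := by
  simp [xDegree]

/-- The operator that multiplies the monomials of degree `a` in `x` and `b` in `t` by `φ a b`. -/
def bidegreeScale (d : ℕ) (φ : ℕ → ℕ → ℝ) :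
    MvPolynomial (Fin (d + 1)) ℝ →ₗ[ℝ] MvPolynomial (Fin (d + 1)) ℝ :=
  (basisMonomials (Fin (d + 1)) ℝ).constr ℝ fun m => monomial m (φ (xDegree m) (m (Fin.last d)))

theorem bidegreeScale_monomial (φ : ℕ → ℕ → ℝ) (m : Fin (d + 1) →₀ ℕ) (c : ℝ) :
    bidegreeScale d φ (monomial m c) = monomial m (φ (xDegree m) (m (Fin.last d)) * c) := by
  have h : (monomial m c : MvPolynomial (Fin (d + 1)) ℝ) = c • basisMonomials _ ℝ m := by
    rw [coe_basisMonomials, smul_monomial, smul_eq_mul, mul_one]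
  rw [h, map_smul, bidegreeScale, Module.Basis.constr_basis, smul_monomial, smul_eq_mul, mul_comm]

theorem coeff_bidegreeScale (φ : ℕ → ℕ → ℝ) (P : MvPolynomial (Fin (d + 1)) ℝ)
    (m : Fin (d + 1) →₀ ℕ) :
    coeff m (bidegreeScale d φ P) = φ (xDegree m) (m (Fin.last d)) * coeff m P := by
  classical
  induction P using MvPolynomial.induction_on' with
  | monomial k c =>
    rw [bidegreeScale_monomial, coeff_monomial, coeff_monomial]
    split_ifs with h
    · rw [h]
    · rw [mul_zero]
  | add p q hp hq => rw [map_add, coeff_add, coeff_add, hp, hq, mul_add]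

theorem bidegreeScale_bidegreeScale (φ ψ : ℕ → ℕ → ℝ) (P : MvPolynomial (Fin (d + 1)) ℝ) :
    bidegreeScale d φ (bidegreeScale d ψ P) = bidegreeScale d (fun a b => φ a b * ψ a b) P := by
  ext m
  simp only [coeff_bidegreeScale, mul_assoc]

theorem xEuler_eq_bidegreeScale (P : MvPolynomial (Fin (d + 1)) ℝ) :
    xEuler d P = bidegreeScale d (fun a _ => a) P := by
  ext m
  rw [coeff_xEuler, coeff_bidegreeScale, xDegree, Nat.cast_sum]

theorem X_last_mul_pderiv_last (P : MvPolynomial (Fin (d + 1)) ℝ) :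
    X (Fin.last d) * pderiv (Fin.last d) P = bidegreeScale d (fun _ b => b) P := by
  classical
  ext m
  rw [coeff_X_mul', coeff_bidegreeScale]
  split_ifs with h
  · have hm : m (Fin.last d) ≠ 0 := Finsupp.mem_support_iff.1 h
    rw [coeff_pderiv, tsub_add_cancel_of_le
      (Finsupp.single_le_iff.2 (Nat.one_le_iff_ne_zero.2 hm)), mul_comm, Finsupp.tsub_apply,
      Finsupp.single_eq_same, ← Nat.cast_add_one, Nat.sub_one_add_one hm]
  · rw [Finsupp.notMem_support_iff.1 h, Nat.cast_zero, zero_mul]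

theorem pderiv_castSucc_bidegreeScale (φ : ℕ → ℕ → ℝ) (i : Fin d)
    (P : MvPolynomial (Fin (d + 1)) ℝ) : pderiv i.castSucc (bidegreeScale d φ P) =
      bidegreeScale d (fun a b => φ (a + 1) b) (pderiv i.castSucc P) := by
  ext m
  simp only [coeff_pderiv, coeff_bidegreeScale, xDegree_add, xDegree_single_castSucc,
    Finsupp.add_apply, Finsupp.single_eq_of_ne (Fin.castSucc_lt_last i).ne', add_zero, mul_assoc]

theorem pderiv_last_bidegreeScale (φ : ℕ → ℕ → ℝ) (P : MvPolynomial (Fin (d + 1)) ℝ) :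
    pderiv (Fin.last d) (bidegreeScale d φ P) =
      bidegreeScale d (fun a b => φ a (b + 1)) (pderiv (Fin.last d) P) := by
  ext m
  simp only [coeff_pderiv, coeff_bidegreeScale, xDegree_add, xDegree_single_last,
    Finsupp.add_apply, Finsupp.single_eq_same, add_zero, mul_assoc]

theorem bidegreeScale_mem_polyLE (φ : ℕ → ℕ → ℝ) {n : ℤ} {P : MvPolynomial (Fin (d + 1)) ℝ}
    (hP : P ∈ polyLE (Fin (d + 1)) ℝ n) : bidegreeScale d φ P ∈ polyLE (Fin (d + 1)) ℝ n := by
  rw [mem_polyLE] at *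
  intro m hm
  rw [coeff_bidegreeScale] at hm
  exact hP m (right_ne_zero_of_mul hm)

theorem bidegreeScale_mem_polyLE_sub_one {φ : ℕ → ℕ → ℝ} {n : ℕ}
    (hφ : ∀ a b, a + b = n → φ a b = 0) {P : MvPolynomial (Fin (d + 1)) ℝ}
    (hP : P ∈ polyLE (Fin (d + 1)) ℝ n) :
    bidegreeScale d φ P ∈ polyLE (Fin (d + 1)) ℝ (n - 1) := by
  rw [mem_polyLE] at *
  intro m hm
  rw [coeff_bidegreeScale] at hm
  have h_le := hP m (right_ne_zero_of_mul hm)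
  have h_ne : m.degree ≠ n := fun h =>
    left_ne_zero_of_mul hm (hφ _ _ ((degree_eq_xDegree_add m).symm.trans h))
  omega

theorem bidegreeScale_mem_xHarmonic (φ : ℕ → ℕ → ℝ) {P : MvPolynomial (Fin (d + 1)) ℝ}
    (hP : P ∈ xHarmonic d) : bidegreeScale d φ P ∈ xHarmonic d := by
  rw [mem_xHarmonic] at *
  simp only [pderiv_castSucc_bidegreeScale, ← map_sum, hP, map_zero]

theorem xEuler_mem_xHarmonic {P : MvPolynomial (Fin (d + 1)) ℝ} (hP : P ∈ xHarmonic d) :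
    xEuler d P ∈ xHarmonic d := by
  rw [xEuler_eq_bidegreeScale]
  exact bidegreeScale_mem_xHarmonic _ hP

theorem pderiv_last_mem_xHarmonic {P : MvPolynomial (Fin (d + 1)) ℝ} (hP : P ∈ xHarmonic d) :
    pderiv (Fin.last d) P ∈ xHarmonic d := by
  rw [mem_xHarmonic] at *
  simp only [pderiv_pderiv_comm _ (Fin.last d), ← map_sum, hP, map_zero]

theorem xLaplacian_X_last_mul (P : MvPolynomial (Fin (d + 1)) ℝ) :
    xLaplacian d (X (Fin.last d) * P) = X (Fin.last d) * xLaplacian d P := by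
  simp only [xLaplacian_apply, pderiv_mul, pderiv_X_of_ne (Fin.castSucc_lt_last _).ne', zero_mul,
    zero_add, Finset.mul_sum]

theorem X_last_mul_mem_xHarmonic {P : MvPolynomial (Fin (d + 1)) ℝ} (hP : P ∈ xHarmonic d) :
    X (Fin.last d) * P ∈ xHarmonic d := by
  rw [xHarmonic, LinearMap.mem_ker] at *
  rw [xLaplacian_X_last_mul, hP, mul_zero]

theorem one_sub_X_last_mul_mem_xHarmonic_iff {P : MvPolynomial (Fin (d + 1)) ℝ} :
    (1 - X (Fin.last d)) * P ∈ xHarmonic d ↔ P ∈ xHarmonic d := by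
  have h : xLaplacian d ((1 - X (Fin.last d)) * P) = (1 - X (Fin.last d)) * xLaplacian d P := by
    rw [sub_mul, one_mul, map_sub, xLaplacian_X_last_mul, sub_mul, one_mul]
  rw [xHarmonic, LinearMap.mem_ker, LinearMap.mem_ker, h, mul_eq_zero,
    or_iff_right (one_sub_X_ne_zero _)]

theorem eulerOp_eq_xEuler_add (P : MvPolynomial (Fin (d + 1)) ℝ) :
    eulerOp (Fin (d + 1)) P = xEuler d P + X (Fin.last d) * pderiv (Fin.last d) P := by
  rw [eulerOp_apply, Fin.sum_univ_castSucc, xEuler]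

end BidegreeScale

/-! ### Moments of polynomials on the cone -/

section Moment

theorem eulerOp_mul {ι : Type*} [Fintype ι] (P Q : MvPolynomial ι ℝ) :
    eulerOp ι (P * Q) = eulerOp ι P * Q + P * eulerOp ι Q := by
  simp only [eulerOp_apply, Finset.sum_mul, Finset.mul_sum, ← Finset.sum_add_distrib]
  exact Finset.sum_congr rfl fun i _ => by rw [pderiv_mul]; ring

variable {d : ℕ}

/-- The integral of `P` over the slice `t = s` of the cone, as a linear functional. -/
def sphereMoment (d : ℕ) (s : ℝ) : MvPolynomial (Fin (d + 1)) ℝ →ₗ[ℝ] ℝ :=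
  sphereIntegral (Fin d) ∘ₗ (coneSlice d s).toLinearMap

theorem sphereMoment_apply (s : ℝ) (P : MvPolynomial (Fin (d + 1)) ℝ) :
    sphereMoment d s P = sphereIntegral (Fin d) (coneSlice d s P) := rfl

theorem sphereMoment_eq_integral (s : ℝ) (P : MvPolynomial (Fin (d + 1)) ℝ) :
    sphereMoment d s P = ∫ ξ, coneVal ξ s (coneMk d P) ∂sphereMeasure d := by
  simp only [sphereMoment_apply, sphereIntegral_apply, eval_coneSlice]
  rfl

theorem sphereMoment_of_isHomogeneous {k : ℕ} {P : MvPolynomial (Fin (d + 1)) ℝ}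
    (hP : P.IsHomogeneous k) (s : ℝ) : sphereMoment d s P = s ^ k * sphereMoment d 1 P := by
  rw [sphereMoment_apply, coneSlice_of_isHomogeneous hP, map_smul, smul_eq_mul, sphereMoment_apply]

theorem continuous_sphereMoment (P : MvPolynomial (Fin (d + 1)) ℝ) :
    Continuous fun s => sphereMoment d s P := by
  induction P using MvPolynomial.induction_on' with
  | monomial m c =>
    exact ((continuous_pow m.degree).mul continuous_const).congr fun s =>
      (sphereMoment_of_isHomogeneous (isHomogeneous_monomial c rfl) s).symm
  | add p q hp hq =>
    simp only [map_add]
    exact hp.add hq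

theorem sphereMoment_X_last_mul (s : ℝ) (P : MvPolynomial (Fin (d + 1)) ℝ) :
    sphereMoment d s (X (Fin.last d) * P) = s * sphereMoment d s P := by
  rw [sphereMoment_apply, map_mul, coneSlice_X_last, ← smul_eq_C_mul, map_smul, smul_eq_mul,
    sphereMoment_apply]

theorem sphereMoment_xEuler_mul [Nonempty (Fin d)] (s : ℝ) {P Q : MvPolynomial (Fin (d + 1)) ℝ}
    (hP : P ∈ xHarmonic d) (hQ : Q ∈ xHarmonic d) :
    sphereMoment d s (xEuler d P * Q) = sphereMoment d s (P * xEuler d Q) := by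
  simp only [sphereMoment_apply, map_mul, ← eulerOp_coneSlice]
  exact sphereIntegral_eulerOp_mul (coneSlice_mem_harmonicPoly s hP)
    (coneSlice_mem_harmonicPoly s hQ)

/-- The integral `∫₀¹ t ^ k ∫ P(tξ, t) dσ(ξ) dt`, as a linear functional of `P`. The power of `t`
absorbs both the factor `t ^ (d - 1)` of the Lebesgue measure of the cone and that of a weight. -/
def coneMoment (d k : ℕ) : MvPolynomial (Fin (d + 1)) ℝ →ₗ[ℝ] ℝ where
  toFun P := ∫ t in (0 : ℝ)..1, t ^ k * sphereMoment d t P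
  map_add' P Q := by
    have h_int (R : MvPolynomial (Fin (d + 1)) ℝ) :
        IntervalIntegrable (fun t => t ^ k * sphereMoment d t R) volume 0 1 :=
      ((continuous_pow k).mul (continuous_sphereMoment R)).intervalIntegrable 0 1
    simp only [map_add, mul_add, intervalIntegral.integral_add (h_int P) (h_int Q)]
  map_smul' c P := by
    simp only [map_smul, smul_eq_mul, RingHom.id_apply, mul_left_comm _ c,
      intervalIntegral.integral_const_mul]

theorem coneMoment_apply (k : ℕ) (P : MvPolynomial (Fin (d + 1)) ℝ) :
    coneMoment d k P = ∫ t in (0 : ℝ)..1, t ^ k * sphereMoment d t P := rfl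

theorem coneMoment_X_last_mul (k : ℕ) (P : MvPolynomial (Fin (d + 1)) ℝ) :
    coneMoment d k (X (Fin.last d) * P) = coneMoment d (k + 1) P := by
  simp only [coneMoment_apply, sphereMoment_X_last_mul, pow_succ, mul_assoc]

theorem coneMoment_xEuler_mul [Nonempty (Fin d)] (k : ℕ) {P Q : MvPolynomial (Fin (d + 1)) ℝ}
    (hP : P ∈ xHarmonic d) (hQ : Q ∈ xHarmonic d) :
    coneMoment d k (xEuler d P * Q) = coneMoment d k (P * xEuler d Q) := by
  simp only [coneMoment_apply, sphereMoment_xEuler_mul _ hP hQ]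

theorem coneMoment_eulerOp_add_smul (k : ℕ) (P : MvPolynomial (Fin (d + 1)) ℝ) :
    coneMoment d k (eulerOp (Fin (d + 1)) P + ((k : ℝ) + 1) • P) = sphereMoment d 1 P := by
  induction P using MvPolynomial.induction_on' with
  | add p q hp hq => rw [(eulerOp _).map_add, smul_add, add_add_add_comm, map_add, hp, hq, map_add]
  | monomial m c =>
    have hm : (monomial m c).IsHomogeneous m.degree := isHomogeneous_monomial c rfl
    have h_pow : ∀ t : ℝ, t ^ k * sphereMoment d t (monomial m c) =
        t ^ (k + m.degree) * sphereMoment d 1 (monomial m c) := fun t => by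
      rw [sphereMoment_of_isHomogeneous hm, pow_add, mul_assoc]
    rw [eulerOp_of_isHomogeneous hm, ← add_smul, map_smul, coneMoment_apply]
    simp only [h_pow, intervalIntegral.integral_mul_const, integral_pow, one_pow, smul_eq_mul]
    push_cast
    field_simp
    ring

/-- Integration by parts in the radial direction: the Euler operator of the cone is
`xEuler + t ∂ₜ`, and `xEuler` can be moved from `P` to `Q` because they are harmonic in `x`. -/
theorem coneMoment_pderiv_last_mul [Nonempty (Fin d)] (k : ℕ)
    {P Q : MvPolynomial (Fin (d + 1)) ℝ} (hP : P ∈ xHarmonic d) (hQ : Q ∈ xHarmonic d) :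
    coneMoment d (k + 1) (pderiv (Fin.last d) P * Q) = sphereMoment d 1 (P * Q) -
      coneMoment d k (P * bidegreeScale d (fun a b => 2 * a + b + k + 1) Q) := by
  have h_scale : bidegreeScale d (fun a b => 2 * a + b + k + 1) Q =
      xEuler d Q + xEuler d Q + X (Fin.last d) * pderiv (Fin.last d) Q + ((k : ℝ) + 1) • Q := by
    rw [X_last_mul_pderiv_last, xEuler_eq_bidegreeScale]
    ext m
    simp only [coeff_add, coeff_smul, coeff_bidegreeScale, smul_eq_mul]
    ring
  rw [← coneMoment_X_last_mul, ← coneMoment_eulerOp_add_smul k (P * Q), eulerOp_mul,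
    eulerOp_eq_xEuler_add, eulerOp_eq_xEuler_add, h_scale]
  simp only [add_mul, mul_add, map_add, mul_smul_comm, coneMoment_xEuler_mul k hP hQ, mul_assoc]
  ring

theorem eq_zero_of_coneSlice_eq_zero {I : Set ℝ} (hI : I.Infinite)
    {P : MvPolynomial (Fin (d + 1)) ℝ} (h : ∀ s ∈ I, coneSlice d s P = 0) : P = 0 := by
  refine funext_set (Fin.snoc (fun _ => Set.univ) (I \ {0})) (fun i => ?_) fun y hy => ?_
  · refine Fin.lastCases ?_ (fun j => ?_) i
    · rw [Fin.snoc_last]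
      exact hI.sdiff (Set.finite_singleton 0)
    · rw [Fin.snoc_castSucc]
      exact Set.infinite_univ
  · have hs : y (Fin.last d) ∈ I \ {0} := by
      simpa only [Fin.snoc_last] using hy (Fin.last d) (Set.mem_univ _)
    have hy_eq : y = Fin.snoc (α := fun _ => ℝ)
        (fun i => y (Fin.last d) * ((y (Fin.last d))⁻¹ * y i.castSucc)) (y (Fin.last d)) := by
      ext i
      refine Fin.lastCases ?_ (fun j => ?_) i
      · rw [Fin.snoc_last]
      · rw [Fin.snoc_castSucc, mul_inv_cancel_left₀ hs.2]
    rw [hy_eq, ← eval_coneSlice, h _ hs.1, map_zero, map_zero]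

theorem eq_zero_of_coneMoment_one_sub_X_last_mul_self [Nonempty (Fin d)] (k : ℕ)
    {P : MvPolynomial (Fin (d + 1)) ℝ} (hP : P ∈ xHarmonic d)
    (h : coneMoment d k ((1 - X (Fin.last d)) * (P * P)) = 0) : P = 0 := by
  have h_moment (t : ℝ) : t ^ k * sphereMoment d t ((1 - X (Fin.last d)) * (P * P)) =
      t ^ k * (1 - t) * sphereIntegral (Fin d) (coneSlice d t P * coneSlice d t P) := by
    rw [sub_mul, one_mul, map_sub, sphereMoment_X_last_mul, sphereMoment_apply, map_mul]
    ring
  refine eq_zero_of_coneSlice_eq_zero (Set.Ioo_infinite (zero_lt_one' ℝ)) fun s hs =>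
    eq_zero_of_harmonicPoly_of_sphereIntegral (coneSlice_mem_harmonicPoly s hP) ?_
  by_contra h_ne
  refine (intervalIntegral.integral_pos zero_lt_one
    (f := fun t => t ^ k * sphereMoment d t ((1 - X (Fin.last d)) * (P * P)))
    ((continuous_pow k).mul (continuous_sphereMoment _)).continuousOn (fun t ht => ?_)
    ⟨s, Set.Ioo_subset_Icc_self hs, ?_⟩).ne' h
  · rw [h_moment]
    exact mul_nonneg (mul_nonneg (pow_nonneg ht.1.le k) (sub_nonneg.2 ht.2))
      (sphereIntegral_mul_self_nonneg _)
  · rw [h_moment]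
    exact mul_pos (mul_pos (pow_pos hs.1 k) (sub_pos.2 hs.2))
      ((sphereIntegral_mul_self_nonneg _).lt_of_ne' h_ne)

end Moment

/-! ### Representatives that are harmonic in `x` -/

section HarmonicRepresentative

variable {d : ℕ}

theorem xLaplacian_mem_polyLE {n : ℤ} {P : MvPolynomial (Fin (d + 1)) ℝ}
    (hP : P ∈ polyLE (Fin (d + 1)) ℝ n) : xLaplacian d P ∈ polyLE (Fin (d + 1)) ℝ (n - 2) := by
  rw [xLaplacian_apply, show n - 2 = n - 1 - 1 by ring]
  exact sum_mem fun i _ => pderiv_mem_polyLE _ (pderiv_mem_polyLE _ hP)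

theorem coneQuadric_mem_polyLE : coneQuadric d ∈ polyLE (Fin (d + 1)) ℝ 2 := by
  have h_sq (i : Fin (d + 1)) :
      (X i ^ 2 : MvPolynomial (Fin (d + 1)) ℝ) ∈ polyLE (Fin (d + 1)) ℝ 2 := by
    rw [sq, show (2 : ℤ) = 1 + 1 by rfl]
    exact mul_mem_polyLE (X_mem_polyLE i) (X_mem_polyLE i)
  rw [coneQuadric]
  exact sub_mem (h_sq _) (sum_mem fun i _ => h_sq _)

theorem coneQuadric_mul_mem_polyLE {n : ℤ} {P : MvPolynomial (Fin (d + 1)) ℝ}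
    (hP : P ∈ polyLE (Fin (d + 1)) ℝ (n - 2)) :
    coneQuadric d * P ∈ polyLE (Fin (d + 1)) ℝ n := by
  simpa only [add_sub_cancel] using mul_mem_polyLE coneQuadric_mem_polyLE hP

instance (n : ℤ) : FiniteDimensional ℝ (polyLE (Fin (d + 1)) ℝ n) :=
  have : FiniteDimensional ℝ (polyLE (Fin (d + 1)) ℝ (n.toNat : ℤ)) := by
    rw [polyLE_natCast]
    infer_instance
  Submodule.finiteDimensional_of_le (polyLE_mono n.self_le_toNat)

theorem exists_xLaplacian_coneQuadric_mul_eq (hd : 2 ≤ d) {n : ℤ}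
    {P : MvPolynomial (Fin (d + 1)) ℝ} (hP : P ∈ polyLE (Fin (d + 1)) ℝ n) :
    ∃ Q ∈ polyLE (Fin (d + 1)) ℝ n, xLaplacian d (coneQuadric d * Q) = P := by
  let T : MvPolynomial (Fin (d + 1)) ℝ →ₗ[ℝ] MvPolynomial (Fin (d + 1)) ℝ :=
    xLaplacian d ∘ₗ LinearMap.mulLeft ℝ (coneQuadric d)
  have hT : ∀ Q ∈ polyLE (Fin (d + 1)) ℝ n, T Q ∈ polyLE (Fin (d + 1)) ℝ n := fun Q hQ => by
    have h := xLaplacian_mem_polyLE (coneQuadric_mul_mem_polyLE (n := n + 2)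
      (by rwa [add_sub_cancel_right]))
    rwa [add_sub_cancel_right] at h
  have hT_inj : Function.Injective (T.restrict hT) :=
    (injective_iff_map_eq_zero _).2 fun Q hQ =>
      Subtype.ext (eq_zero_of_xLaplacian_coneQuadric_mul hd (congrArg Subtype.val hQ))
  obtain ⟨Q, hQ⟩ := LinearMap.injective_iff_surjective.1 hT_inj ⟨P, hP⟩
  exact ⟨Q.1, Q.2, congrArg Subtype.val hQ⟩

/-- The polynomials in `(x, t)` that are harmonic in `x` and have total degree at most `n`. -/
def xHarmonicLE (d : ℕ) (n : ℤ) : Submodule ℝ (MvPolynomial (Fin (d + 1)) ℝ) :=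
  xHarmonic d ⊓ polyLE (Fin (d + 1)) ℝ n

theorem conePolyLE_eq_map_xHarmonicLE (hd : 2 ≤ d) (n : ℤ) :
    conePolyLE d n = (xHarmonicLE d n).map (coneMk d).toLinearMap := by
  refine le_antisymm ?_ (Submodule.map_mono inf_le_right)
  rintro _ ⟨P, hP, rfl⟩
  obtain ⟨Q, hQ, hQP⟩ := exists_xLaplacian_coneQuadric_mul_eq hd (xLaplacian_mem_polyLE hP)
  refine ⟨P - coneQuadric d * Q, ⟨?_, sub_mem hP (coneQuadric_mul_mem_polyLE hQ)⟩, ?_⟩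
  · rw [SetLike.mem_coe, xHarmonic, LinearMap.mem_ker, map_sub, hQP, sub_self]
  · refine Ideal.Quotient.eq.2 (Ideal.mem_span_singleton.2 ⟨-Q, ?_⟩)
    ring

theorem eq_of_coneMk_eq (hd : 2 ≤ d) {P Q : MvPolynomial (Fin (d + 1)) ℝ}
    (hP : P ∈ xHarmonic d) (hQ : Q ∈ xHarmonic d) (h : coneMk d P = coneMk d Q) : P = Q :=
  congrArg Subtype.val ((xHarmonic_bijective hd).1 (a₁ := ⟨P, hP⟩) (a₂ := ⟨Q, hQ⟩) h)

theorem bidegreeScale_mem_xHarmonicLE (φ : ℕ → ℕ → ℝ) {n : ℤ} {P : MvPolynomial (Fin (d + 1)) ℝ}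
    (hP : P ∈ xHarmonicLE d n) : bidegreeScale d φ P ∈ xHarmonicLE d n :=
  ⟨bidegreeScale_mem_xHarmonic φ hP.1, bidegreeScale_mem_polyLE φ hP.2⟩

theorem X_last_mul_mem_xHarmonicLE {n : ℤ} {P : MvPolynomial (Fin (d + 1)) ℝ}
    (hP : P ∈ xHarmonicLE d (n - 1)) : X (Fin.last d) * P ∈ xHarmonicLE d n := by
  have h := mul_mem_polyLE (X_mem_polyLE (Fin.last d)) hP.2
  rw [add_sub_cancel] at h
  exact ⟨X_last_mul_mem_xHarmonic hP.1, h⟩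

theorem one_sub_X_last_mul_mem_xHarmonicLE_iff {n : ℤ} {P : MvPolynomial (Fin (d + 1)) ℝ} :
    (1 - X (Fin.last d)) * P ∈ xHarmonicLE d n ↔ P ∈ xHarmonicLE d (n - 1) :=
  and_congr one_sub_X_last_mul_mem_xHarmonic_iff
    ⟨mem_polyLE_of_one_sub_X_mul _, one_sub_X_mul_mem_polyLE _⟩

theorem rename_mem_xHarmonicLE {n : ℤ} {Y : MvPolynomial (Fin d) ℝ}
    (hY : Y ∈ harmonicPoly (Fin d)) (hYn : Y ∈ polyLE (Fin d) ℝ n) :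
    rename Fin.castSucc Y ∈ xHarmonicLE d n :=
  ⟨rename_mem_xHarmonic hY, rename_mem_polyLE hYn⟩

theorem exists_eq_rename_coneSlice_one_add {n : ℤ} {P : MvPolynomial (Fin (d + 1)) ℝ}
    (hP : P ∈ xHarmonicLE d n) : ∃ R ∈ xHarmonicLE d (n - 1),
      P = rename Fin.castSucc (coneSlice d 1 P) + (1 - X (Fin.last d)) * R := by
  obtain ⟨R, hR⟩ := one_sub_X_last_dvd_sub_rename_coneSlice_one P
  refine ⟨R, one_sub_X_last_mul_mem_xHarmonicLE_iff.1 ?_, eq_add_of_sub_eq' hR⟩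
  rw [← hR]
  exact sub_mem hP (rename_mem_xHarmonicLE (coneSlice_mem_harmonicPoly 1 hP.1)
    (coneSlice_mem_polyLE 1 hP.2))

end HarmonicRepresentative

/-! ### The inner products on harmonic representatives -/

section InnerProduct

variable {d : ℕ}

/-- The inner product `⟨·, ·⟩_{-1,-1}`, up to the factor `ω_d⁻¹`, on the representatives that are
harmonic in `x`. -/
def sobolevForm (d : ℕ) (lam : ℝ) : LinearMap.BilinForm ℝ (MvPolynomial (Fin (d + 1)) ℝ) :=
  ((LinearMap.mul ℝ _).compr₂ (coneMoment d (d - 1))).compl₁₂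
      (pderiv (Fin.last d)).toLinearMap (pderiv (Fin.last d)).toLinearMap
    + lam • (LinearMap.mul ℝ _).compr₂ (sphereMoment d 1)

/-- The inner product `⟨·, ·⟩_{-1,1}`, up to normalization, on representatives. The factor `t⁻¹` of
the weight is absorbed into the exponent of the moment. -/
def jacobiForm (d : ℕ) : LinearMap.BilinForm ℝ (MvPolynomial (Fin (d + 1)) ℝ) :=
  (LinearMap.mul ℝ _).compr₂
    (coneMoment d (d - 2) ∘ₗ LinearMap.mulLeft ℝ (1 - X (Fin.last d)))

theorem sobolevForm_apply (lam : ℝ) (P Q : MvPolynomial (Fin (d + 1)) ℝ) :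
    sobolevForm d lam P Q =
      coneMoment d (d - 1) (pderiv (Fin.last d) P * pderiv (Fin.last d) Q) +
        lam * sphereMoment d 1 (P * Q) := rfl

theorem jacobiForm_apply (P Q : MvPolynomial (Fin (d + 1)) ℝ) :
    jacobiForm d P Q = coneMoment d (d - 2) ((1 - X (Fin.last d)) * (P * Q)) := rfl

theorem sobolevForm_comm (lam : ℝ) (P Q : MvPolynomial (Fin (d + 1)) ℝ) :
    sobolevForm d lam P Q = sobolevForm d lam Q P := by
  simp only [sobolevForm_apply, mul_comm P, mul_comm (pderiv _ P)]

theorem jacobiForm_comm (P Q : MvPolynomial (Fin (d + 1)) ℝ) :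
    jacobiForm d P Q = jacobiForm d Q P := by
  simp only [jacobiForm_apply, mul_comm P]

theorem coneBoundaryIntegral_coneMk (P : MvPolynomial (Fin (d + 1)) ℝ) :
    coneBoundaryIntegral d (coneMk d P) = sphereMoment d 1 P :=
  (sphereMoment_eq_integral 1 P).symm

theorem coneWeightedIntegral_coneMk_zero (hd : 2 ≤ d) (hβ : -(d : ℝ) < -1 + 1)
    (hγ : -1 < (0 : ℝ)) (P : MvPolynomial (Fin (d + 1)) ℝ) :
    coneWeightedIntegral hd hβ hγ (coneMk d P) = coneMoment d (d - 1) P := by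
  rw [coneMoment_apply]
  refine intervalIntegral.integral_congr fun t _ => ?_
  simp only [jacobiWeight, neg_add_cancel, Real.rpow_zero, mul_one, sphereMoment_eq_integral]

theorem coneWeightedIntegral_coneMk_neg_one_one (hd : 2 ≤ d) (hβ : -(d : ℝ) < -1)
    (hγ : -1 < (1 : ℝ)) (P : MvPolynomial (Fin (d + 1)) ℝ) :
    coneWeightedIntegral hd hβ hγ (coneMk d P) =
      coneMoment d (d - 2) ((1 - X (Fin.last d)) * P) := by
  rw [coneMoment_apply]
  refine intervalIntegral.integral_congr_ae (.of_forall fun t ht => ?_)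
  rw [Set.uIoc_of_le zero_le_one] at ht
  have ht0 : t ≠ 0 := ht.1.ne'
  rw [sub_mul, one_mul, map_sub, sphereMoment_X_last_mul, integral_mul_const,
    sphereMoment_eq_integral, jacobiWeight, Real.rpow_neg_one, Real.rpow_one,
    show d - 1 = d - 2 + 1 by omega, pow_succ]
  field_simp

theorem sphereArea_pos [Nonempty (Fin d)] : 0 < sphereArea d := by
  have : NeZero (sphereMeasure d) := ⟨Measure.toSphere_ne_zero _⟩
  exact measureReal_univ_pos

theorem coneNorm_pos [Nonempty (Fin d)] {β γ : ℝ} (hβ : -(d : ℝ) < β) (hγ : -1 < γ) :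
    0 < coneNorm d β γ := by
  rw [coneNorm]
  exact mul_pos (inv_pos.2 sphereArea_pos) (div_pos (Real.Gamma_pos_of_pos (by linarith))
    (mul_pos (Real.Gamma_pos_of_pos (by linarith)) (Real.Gamma_pos_of_pos (by linarith))))

theorem jacobiInner_coneMk (hd : 2 ≤ d) (hβ : -(d : ℝ) < -1) (hγ : -1 < (1 : ℝ))
    (P Q : MvPolynomial (Fin (d + 1)) ℝ) :
    jacobiInner hd (-1) 1 hβ hγ (coneMk d P) (coneMk d Q) =
      coneNorm d (-1) 1 * jacobiForm d P Q := by
  rw [jacobiForm_apply, ← coneWeightedIntegral_coneMk_neg_one_one hd hβ hγ, map_mul]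
  rfl

theorem sobolevInner_coneMk (hd : 2 ≤ d) (hβ : -(d : ℝ) < -1 + 1) (lam : ℝ)
    {P Q : MvPolynomial (Fin (d + 1)) ℝ} (hP : P ∈ xHarmonic d) (hQ : Q ∈ xHarmonic d) :
    sobolevInner hd (-1) hβ lam (coneMk d P) (coneMk d Q) =
      (sphereArea d)⁻¹ * sobolevForm d lam P Q := by
  rw [sobolevForm_apply, ← coneWeightedIntegral_coneMk_zero hd hβ (by norm_num),
    ← coneBoundaryIntegral_coneMk, map_mul (coneMk d), map_mul (coneMk d),
    ← coneDt_coneMk hd hP, ← coneDt_coneMk hd hQ, mul_add, ← mul_assoc _ lam, mul_comm _ lam]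
  rfl

/-- The analogue of `orthPoly` for representatives: the polynomials harmonic in `x`, of degree at
most `n`, that are orthogonal to all those of degree at most `n - 1`. -/
def harmonicOrthPoly (B : LinearMap.BilinForm ℝ (MvPolynomial (Fin (d + 1)) ℝ)) (n : ℤ) :
    Submodule ℝ (MvPolynomial (Fin (d + 1)) ℝ) :=
  xHarmonicLE d n ⊓ B.orthogonal (xHarmonicLE d (n - 1))

theorem orthPoly_eq_map_harmonicOrthPoly (hd : 2 ≤ d) {A : LinearMap.BilinForm ℝ (ConePoly d)}
    {B : LinearMap.BilinForm ℝ (MvPolynomial (Fin (d + 1)) ℝ)} {c : ℝ} (hc : c ≠ 0)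
    (h : ∀ P ∈ xHarmonic d, ∀ Q ∈ xHarmonic d, A (coneMk d P) (coneMk d Q) = c * B P Q) (n : ℤ) :
    orthPoly A n = (harmonicOrthPoly B n).map (coneMk d).toLinearMap := by
  rw [orthPoly, conePolyLE_eq_map_xHarmonicLE hd, conePolyLE_eq_map_xHarmonicLE hd]
  refine le_antisymm ?_ ?_
  · rintro _ ⟨⟨P, hP, rfl⟩, hP_orth⟩
    refine ⟨P, ⟨hP, fun Q hQ => ?_⟩, rfl⟩
    have hPQ := hP_orth _ (Submodule.mem_map_of_mem hQ)
    exact (mul_eq_zero.1 ((h Q hQ.1 P hP.1).symm.trans hPQ)).resolve_left hc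
  · rintro _ ⟨P, ⟨hP, hP_orth⟩, rfl⟩
    refine ⟨Submodule.mem_map_of_mem hP, ?_⟩
    rintro _ ⟨Q, hQ, rfl⟩
    have hPQ : B Q P = 0 := hP_orth Q hQ
    exact (h Q hQ.1 P hP.1).trans (by rw [hPQ, mul_zero])

theorem sobolevSpace_eq_map (hd : 2 ≤ d) (hβ : -(d : ℝ) < -1 + 1) (lam : ℝ) (n : ℤ) :
    sobolevSpace hd (-1) hβ lam n =
      (harmonicOrthPoly (sobolevForm d lam) n).map (coneMk d).toLinearMap :=
  have : Nonempty (Fin d) := ⟨⟨0, by omega⟩⟩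
  orthPoly_eq_map_harmonicOrthPoly hd (inv_ne_zero sphereArea_pos.ne')
    (fun _ hP _ hQ => sobolevInner_coneMk hd hβ lam hP hQ) n

theorem jacobiSpace_eq_map (hd : 2 ≤ d) (hβ : -(d : ℝ) < -1) (hγ : -1 < (1 : ℝ)) (n : ℤ) :
    jacobiSpace hd (-1) 1 hβ hγ n =
      (harmonicOrthPoly (jacobiForm d) n).map (coneMk d).toLinearMap :=
  have : Nonempty (Fin d) := ⟨⟨0, by omega⟩⟩
  orthPoly_eq_map_harmonicOrthPoly hd (coneNorm_pos hβ hγ).ne'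
    (fun P _ Q _ => jacobiInner_coneMk hd hβ hγ P Q) n

end InnerProduct

/-! ### The differential operator on harmonic representatives -/

section ConeOp

variable {d : ℕ}

/-- The radial part `t ∂ₜ² + (2 xEuler + d - 1) ∂ₜ` of the differential operator: for a solid
harmonic `Y` of degree `a`, it maps `p(t) Y(x)` to `(t p'' + (2 a + d - 1) p') Y(x)`. -/
def radialOp (d : ℕ) : MvPolynomial (Fin (d + 1)) ℝ →ₗ[ℝ] MvPolynomial (Fin (d + 1)) ℝ :=
  bidegreeScale d (fun a b => 2 * a + b + (d - 1)) ∘ₗ (pderiv (Fin.last d)).toLinearMap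

/-- The operator `-Δ₀` of the unit sphere, which multiplies a spherical harmonic of degree `a` by
`a (a + d - 2)`. -/
def sphericalOp (d : ℕ) : MvPolynomial (Fin (d + 1)) ℝ →ₗ[ℝ] MvPolynomial (Fin (d + 1)) ℝ :=
  bidegreeScale d fun a _ => a * (a + (d - 2))

/-- The action of the differential operator `D_{-1}` on the representatives that are harmonic
in `x`. -/
def coneOp (d : ℕ) : MvPolynomial (Fin (d + 1)) ℝ →ₗ[ℝ] MvPolynomial (Fin (d + 1)) ℝ :=
  LinearMap.mulLeft ℝ (1 - X (Fin.last d)) ∘ₗ radialOp d - sphericalOp d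

theorem radialOp_apply (P : MvPolynomial (Fin (d + 1)) ℝ) :
    radialOp d P = bidegreeScale d (fun a b => 2 * a + b + (d - 1)) (pderiv (Fin.last d) P) := rfl

theorem coneOp_apply (P : MvPolynomial (Fin (d + 1)) ℝ) :
    coneOp d P = (1 - X (Fin.last d)) * radialOp d P - sphericalOp d P := rfl

theorem sphericalOp_eq_xEuler (P : MvPolynomial (Fin (d + 1)) ℝ) :
    sphericalOp d P = xEuler d (xEuler d P) + ((d : ℝ) - 2) • xEuler d P := by
  ext m
  simp only [sphericalOp, xEuler_eq_bidegreeScale, coeff_add, coeff_smul, coeff_bidegreeScale,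
    smul_eq_mul]
  ring

theorem X_last_mul_radialOp (P : MvPolynomial (Fin (d + 1)) ℝ) :
    X (Fin.last d) * radialOp d P = bidegreeScale d (fun a b => b * (2 * a + b + (d - 2))) P := by
  have h : radialOp d P =
      pderiv (Fin.last d) (bidegreeScale d (fun a b => 2 * a + b + (d - 2)) P) := by
    rw [radialOp_apply, pderiv_last_bidegreeScale]
    congr! 4
    push_cast
    ring
  rw [h, X_last_mul_pderiv_last, bidegreeScale_bidegreeScale]

theorem coneOp_eq_radialOp_sub (P : MvPolynomial (Fin (d + 1)) ℝ) :
    coneOp d P =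
      radialOp d P - bidegreeScale d (fun a b => (a + b) * (a + b + (d - 2))) P := by
  rw [coneOp_apply, sub_mul, one_mul, X_last_mul_radialOp, sub_sub, sphericalOp]
  congr 1
  ext m
  simp only [coeff_add, coeff_bidegreeScale]
  ring

theorem radialOp_mem_xHarmonic {P : MvPolynomial (Fin (d + 1)) ℝ} (hP : P ∈ xHarmonic d) :
    radialOp d P ∈ xHarmonic d := by
  rw [radialOp_apply]
  exact bidegreeScale_mem_xHarmonic _ (pderiv_last_mem_xHarmonic hP)

theorem radialOp_mem_xHarmonicLE {n : ℤ} {P : MvPolynomial (Fin (d + 1)) ℝ}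
    (hP : P ∈ xHarmonicLE d n) : radialOp d P ∈ xHarmonicLE d (n - 1) := by
  refine ⟨radialOp_mem_xHarmonic hP.1, ?_⟩
  rw [radialOp_apply]
  exact bidegreeScale_mem_polyLE _ (pderiv_mem_polyLE _ hP.2)

theorem coneOp_mem_xHarmonicLE {n : ℤ} {P : MvPolynomial (Fin (d + 1)) ℝ}
    (hP : P ∈ xHarmonicLE d n) : coneOp d P ∈ xHarmonicLE d n :=
  sub_mem (one_sub_X_last_mul_mem_xHarmonicLE_iff.2 (radialOp_mem_xHarmonicLE hP))
    (bidegreeScale_mem_xHarmonicLE _ hP)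

theorem coneOp_add_smul_mem_xHarmonicLE {n : ℕ} {P : MvPolynomial (Fin (d + 1)) ℝ}
    (hP : P ∈ xHarmonicLE d n) :
    coneOp d P + ((n : ℝ) * (n + d - 2)) • P ∈ xHarmonicLE d (n - 1) := by
  let φ : ℕ → ℕ → ℝ := fun a b => n * (n + d - 2) - (a + b) * (a + b + (d - 2))
  have h_eq : coneOp d P + ((n : ℝ) * (n + d - 2)) • P = radialOp d P + bidegreeScale d φ P := by
    rw [coneOp_eq_radialOp_sub]
    ext m
    simp only [coeff_add, coeff_sub, coeff_smul, coeff_bidegreeScale, smul_eq_mul, φ]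
    ring
  have hφ (a b : ℕ) (hab : a + b = n) : φ a b = 0 := by
    simp only [φ, ← hab]
    push_cast
    ring
  rw [h_eq]
  exact add_mem (radialOp_mem_xHarmonicLE hP)
    ⟨bidegreeScale_mem_xHarmonic φ hP.1, bidegreeScale_mem_polyLE_sub_one hφ hP.2⟩

theorem radialOp_X_last_mul (P : MvPolynomial (Fin (d + 1)) ℝ) :
    radialOp d (X (Fin.last d) * P) =
      bidegreeScale d (fun a b => (2 * a + b + (d - 1)) * (b + 1)) P := by
  rw [radialOp_apply, pderiv_mul, pderiv_X_self, one_mul, X_last_mul_pderiv_last]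
  ext m
  simp only [coeff_add, coeff_bidegreeScale]
  ring

theorem exists_radialOp_eq (hd : 2 ≤ d) {n : ℤ} {R : MvPolynomial (Fin (d + 1)) ℝ}
    (hR : R ∈ xHarmonicLE d (n - 1)) : ∃ Q ∈ xHarmonicLE d n, radialOp d Q = R := by
  refine ⟨X (Fin.last d) *
      bidegreeScale d (fun a b => ((2 * a + b + (d - 1)) * (b + 1))⁻¹) R,
    X_last_mul_mem_xHarmonicLE (bidegreeScale_mem_xHarmonicLE _ hR), ?_⟩
  have hd' : (0 : ℝ) < d - 1 := by
    have : (2 : ℝ) ≤ d := by exact_mod_cast hd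
    linarith
  have h_ne (a b : ℕ) : (2 * a + b + (d - 1)) * (b + 1) ≠ (0 : ℝ) := by positivity
  rw [radialOp_X_last_mul, bidegreeScale_bidegreeScale]
  ext m
  rw [coeff_bidegreeScale, mul_inv_cancel₀ (h_ne _ _), one_mul]

end ConeOp

/-! ### Sobolev orthogonal polynomials -/

section SobolevOrthogonal

variable {d : ℕ}

/-- Integration by parts removes `∂ₜ` from the factor that vanishes on the boundary `t = 1`. -/
theorem sobolevForm_one_sub_X_last_mul (hd : 2 ≤ d) (lam : ℝ) {P Q : MvPolynomial (Fin (d + 1)) ℝ}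
    (hP : P ∈ xHarmonic d) (hQ : Q ∈ xHarmonic d) :
    sobolevForm d lam ((1 - X (Fin.last d)) * P) Q = -jacobiForm d P (radialOp d Q) := by
  have : Nonempty (Fin d) := ⟨⟨0, by omega⟩⟩
  have h_boundary (R : MvPolynomial (Fin (d + 1)) ℝ) :
      sphereMoment d 1 ((1 - X (Fin.last d)) * P * R) = 0 := by
    rw [mul_assoc, sphereMoment_apply, coneSlice_one_one_sub_X_last_mul, map_zero]
  have h_scale (a b : ℕ) : (2 * a + b + (d - 2 : ℕ) + 1 : ℝ) = 2 * a + b + (d - 1) := by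
    push_cast [hd]
    ring
  rw [sobolevForm_apply, h_boundary, mul_zero, add_zero, show d - 1 = d - 2 + 1 by omega,
    coneMoment_pderiv_last_mul _ (one_sub_X_last_mul_mem_xHarmonic_iff.2 hP)
      (pderiv_last_mem_xHarmonic hQ), h_boundary, zero_sub, jacobiForm_apply, radialOp_apply,
    mul_assoc]
  simp only [h_scale]

theorem sobolevForm_rename (lam : ℝ) (P : MvPolynomial (Fin (d + 1)) ℝ)
    (Y : MvPolynomial (Fin d) ℝ) :
    sobolevForm d lam (rename Fin.castSucc Y) P =
      lam * sphereIntegral (Fin d) (coneSlice d 1 P * Y) := by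
  rw [sobolevForm_apply, pderiv_last_rename, zero_mul, map_zero, zero_add, sphereMoment_apply,
    map_mul, coneSlice_one_rename, mul_comm Y]

theorem sobolevForm_xEuler [Nonempty (Fin d)] (lam : ℝ) {P Q : MvPolynomial (Fin (d + 1)) ℝ}
    (hP : P ∈ xHarmonic d) (hQ : Q ∈ xHarmonic d) :
    sobolevForm d lam (xEuler d P) Q = sobolevForm d lam P (xEuler d Q) := by
  have h_comm (R : MvPolynomial (Fin (d + 1)) ℝ) :
      pderiv (Fin.last d) (xEuler d R) = xEuler d (pderiv (Fin.last d) R) := by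
    rw [xEuler_eq_bidegreeScale, xEuler_eq_bidegreeScale, pderiv_last_bidegreeScale]
  rw [sobolevForm_apply, sobolevForm_apply, h_comm, h_comm, sphereMoment_xEuler_mul 1 hP hQ,
    coneMoment_xEuler_mul _ (pderiv_last_mem_xHarmonic hP) (pderiv_last_mem_xHarmonic hQ)]

theorem sobolevForm_sphericalOp [Nonempty (Fin d)] (lam : ℝ)
    {P Q : MvPolynomial (Fin (d + 1)) ℝ} (hP : P ∈ xHarmonic d) (hQ : Q ∈ xHarmonic d) :
    sobolevForm d lam (sphericalOp d P) Q = sobolevForm d lam P (sphericalOp d Q) := by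
  simp only [sphericalOp_eq_xEuler, map_add, map_smul, LinearMap.add_apply, LinearMap.smul_apply]
  rw [sobolevForm_xEuler lam (xEuler_mem_xHarmonic hP) hQ, sobolevForm_xEuler lam hP hQ,
    sobolevForm_xEuler lam hP (xEuler_mem_xHarmonic hQ)]

theorem sobolevForm_coneOp (hd : 2 ≤ d) (lam : ℝ) {P Q : MvPolynomial (Fin (d + 1)) ℝ}
    (hP : P ∈ xHarmonic d) (hQ : Q ∈ xHarmonic d) :
    sobolevForm d lam (coneOp d P) Q = sobolevForm d lam P (coneOp d Q) := by
  have : Nonempty (Fin d) := ⟨⟨0, by omega⟩⟩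
  rw [coneOp_apply, coneOp_apply, map_sub, map_sub, LinearMap.sub_apply,
    sobolevForm_sphericalOp lam hP hQ, sobolevForm_comm lam P ((1 - X (Fin.last d)) * _),
    sobolevForm_one_sub_X_last_mul hd lam (radialOp_mem_xHarmonic hP) hQ,
    sobolevForm_one_sub_X_last_mul hd lam (radialOp_mem_xHarmonic hQ) hP, jacobiForm_comm]

theorem eq_zero_of_sobolevForm_eq_zero (hd : 2 ≤ d) {lam : ℝ} (hlam : lam ≠ 0) {n : ℤ}
    {P : MvPolynomial (Fin (d + 1)) ℝ} (hP : P ∈ xHarmonicLE d n)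
    (h : ∀ Q ∈ xHarmonicLE d n, sobolevForm d lam Q P = 0) : P = 0 := by
  have : Nonempty (Fin d) := ⟨⟨0, by omega⟩⟩
  have h_slice : coneSlice d 1 P = 0 := by
    have hY := coneSlice_mem_harmonicPoly 1 hP.1
    have h_test := h _ (rename_mem_xHarmonicLE hY (coneSlice_mem_polyLE 1 hP.2))
    rw [sobolevForm_rename] at h_test
    exact eq_zero_of_harmonicPoly_of_sphereIntegral hY ((mul_eq_zero.1 h_test).resolve_left hlam)
  obtain ⟨R, hR, hPR⟩ := exists_eq_rename_coneSlice_one_add hP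
  rw [h_slice, map_zero, zero_add] at hPR
  obtain ⟨Q, hQ, hQR⟩ := exists_radialOp_eq hd hR
  have hR_zero : jacobiForm d R R = 0 := by
    have h_test := h Q hQ
    rwa [sobolevForm_comm, hPR, sobolevForm_one_sub_X_last_mul hd lam hR.1 hQ.1, hQR,
      neg_eq_zero] at h_test
  rw [hPR, eq_zero_of_coneMoment_one_sub_X_last_mul_self _ hR.1 hR_zero, mul_zero]

theorem coneOp_eq_neg_smul (hd : 2 ≤ d) {lam : ℝ} (hlam : lam ≠ 0) {n : ℕ}
    {Z : MvPolynomial (Fin (d + 1)) ℝ} (hZ : Z ∈ harmonicOrthPoly (sobolevForm d lam) n) :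
    coneOp d Z = -((n : ℝ) * (n + d - 2)) • Z := by
  obtain ⟨hZn, hZ_orth⟩ := hZ
  rw [neg_smul]
  refine eq_neg_of_add_eq_zero_left (eq_zero_of_sobolevForm_eq_zero hd hlam
    (coneOp_add_smul_mem_xHarmonicLE hZn) fun Q hQ => ?_)
  have h_left : sobolevForm d lam Q Z = 0 := hZ_orth Q hQ
  have h_right : sobolevForm d lam (coneOp d Q) Z = 0 := hZ_orth _ (coneOp_mem_xHarmonicLE hQ)
  rw [map_add, map_smul, ← sobolevForm_coneOp hd lam hQ.1 hZn.1, h_left, h_right, smul_zero,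
    add_zero]

theorem rename_mem_harmonicOrthPoly_sobolevForm (hd : 2 ≤ d) (lam : ℝ) {n : ℕ}
    {Y : MvPolynomial (Fin d) ℝ} (hY : Y ∈ solidHarmonic d n) :
    rename Fin.castSucc Y ∈ harmonicOrthPoly (sobolevForm d lam) n := by
  have : Nonempty (Fin d) := ⟨⟨0, by omega⟩⟩
  have hYn : Y.IsHomogeneous n := hY.1
  refine ⟨rename_mem_xHarmonicLE hY.2 (mem_polyLE_natCast.2 hYn.totalDegree_le), fun Q hQ => ?_⟩
  change sobolevForm d lam Q _ = 0
  rw [sobolevForm_comm, sobolevForm_rename, sphereIntegral_mul_eq_zero_of_mem_polyLE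
    (coneSlice_mem_harmonicPoly 1 hQ.1) (coneSlice_mem_polyLE 1 hQ.2) hY.2 hYn, mul_zero]

theorem one_sub_X_last_mul_mem_harmonicOrthPoly_iff (hd : 2 ≤ d) (lam : ℝ) {n : ℤ}
    {P : MvPolynomial (Fin (d + 1)) ℝ} :
    (1 - X (Fin.last d)) * P ∈ harmonicOrthPoly (sobolevForm d lam) n ↔
      P ∈ harmonicOrthPoly (jacobiForm d) (n - 1) := by
  refine (and_congr_left' one_sub_X_last_mul_mem_xHarmonicLE_iff).trans
    (and_congr_right fun hP => ?_)
  have h_form {Q : MvPolynomial (Fin (d + 1)) ℝ} (hQ : Q ∈ xHarmonicLE d (n - 1)) :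
      sobolevForm d lam Q ((1 - X (Fin.last d)) * P) = -jacobiForm d (radialOp d Q) P := by
    rw [sobolevForm_comm, sobolevForm_one_sub_X_last_mul hd lam hP.1 hQ.1, jacobiForm_comm]
  constructor
  · intro h R hR
    obtain ⟨Q, hQ, rfl⟩ := exists_radialOp_eq hd hR
    exact neg_eq_zero.1 ((h_form hQ).symm.trans (h Q hQ))
  · intro h Q hQ
    exact (h_form hQ).trans (neg_eq_zero.2 (h _ (radialOp_mem_xHarmonicLE hQ)))

theorem coneSlice_one_mem_solidHarmonic (hd : 2 ≤ d) {lam : ℝ} (hlam : lam ≠ 0) {n : ℕ}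
    {Z : MvPolynomial (Fin (d + 1)) ℝ} (hZ : Z ∈ harmonicOrthPoly (sobolevForm d lam) n) :
    coneSlice d 1 Z ∈ solidHarmonic d n := by
  have : Nonempty (Fin d) := ⟨⟨0, by omega⟩⟩
  have hY := coneSlice_mem_harmonicPoly 1 hZ.1.1
  refine ⟨isHomogeneous_of_sphereIntegral_mul_eq_zero hY (coneSlice_mem_polyLE 1 hZ.1.2)
    fun Q hQ hQn => ?_, hY⟩
  have h_test : sobolevForm d lam (rename Fin.castSucc Q) Z = 0 :=
    hZ.2 _ (rename_mem_xHarmonicLE hQ hQn)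
  rw [sobolevForm_rename] at h_test
  exact (mul_eq_zero.1 h_test).resolve_left hlam

theorem harmonicOrthPoly_sobolevForm_eq_sup (hd : 2 ≤ d) {lam : ℝ} (hlam : lam ≠ 0) (n : ℕ) :
    harmonicOrthPoly (sobolevForm d lam) n =
      (solidHarmonic d n).map (rename Fin.castSucc).toLinearMap ⊔
        (harmonicOrthPoly (jacobiForm d) (n - 1)).map
          (LinearMap.mulLeft ℝ (1 - X (Fin.last d))) := by
  refine le_antisymm (fun Z hZ => ?_) (sup_le ?_ ?_)
  · have hY := coneSlice_one_mem_solidHarmonic hd hlam hZ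
    obtain ⟨R, -, hZR⟩ := exists_eq_rename_coneSlice_one_add hZ.1
    have hR : (1 - X (Fin.last d)) * R ∈ harmonicOrthPoly (sobolevForm d lam) n := by
      rw [← sub_eq_of_eq_add' hZR]
      exact sub_mem hZ (rename_mem_harmonicOrthPoly_sobolevForm hd lam hY)
    exact Submodule.mem_sup.2 ⟨_, Submodule.mem_map_of_mem hY, _, Submodule.mem_map_of_mem
      ((one_sub_X_last_mul_mem_harmonicOrthPoly_iff hd lam).1 hR), hZR.symm⟩
  · rintro _ ⟨Y, hY, rfl⟩
    exact rename_mem_harmonicOrthPoly_sobolevForm hd lam hY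
  · rintro _ ⟨P, hP, rfl⟩
    exact (one_sub_X_last_mul_mem_harmonicOrthPoly_iff hd lam).2 hP

theorem sobolevSpace_eq_sup (hd : 2 ≤ d) (hβ : -(d : ℝ) < -1 + 1) (hβ' : -(d : ℝ) < -1)
    (hγ : -1 < (1 : ℝ)) {lam : ℝ} (hlam : lam ≠ 0) (n : ℕ) :
    sobolevSpace hd (-1) hβ lam n = coneSolidHarmonic d n ⊔
      (jacobiSpace hd (-1) 1 hβ' hγ (n - 1)).map (LinearMap.mulLeft ℝ (1 - coneT d)) := by
  have h_mul : (coneMk d).toLinearMap ∘ₗ LinearMap.mulLeft ℝ (1 - X (Fin.last d)) =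
      LinearMap.mulLeft ℝ (1 - coneT d) ∘ₗ (coneMk d).toLinearMap :=
    LinearMap.ext fun P => (map_mul (coneMk d) _ P).trans (by rw [map_sub, map_one]; rfl)
  have h_solid : coneSolidHarmonic d n =
      ((solidHarmonic d n).map (rename Fin.castSucc).toLinearMap).map (coneMk d).toLinearMap := by
    rw [← Submodule.map_comp]
    rfl
  rw [sobolevSpace_eq_map, jacobiSpace_eq_map, harmonicOrthPoly_sobolevForm_eq_sup hd hlam,
    Submodule.map_sup, h_solid, ← Submodule.map_comp _ (coneMk d).toLinearMap
      (harmonicOrthPoly _ _), h_mul, Submodule.map_comp]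

theorem disjoint_coneSolidHarmonic (hd : 2 ≤ d) (hβ : -(d : ℝ) < -1) (hγ : -1 < (1 : ℝ))
    (m : ℕ) (n : ℤ) : Disjoint (coneSolidHarmonic d m)
      ((jacobiSpace hd (-1) 1 hβ hγ n).map (LinearMap.mulLeft ℝ (1 - coneT d))) := by
  rw [jacobiSpace_eq_map, Submodule.disjoint_def]
  rintro _ ⟨Y, hY, rfl⟩ ⟨_, ⟨P, hP, rfl⟩, hPY⟩
  have h_eq : (1 - X (Fin.last d)) * P = rename Fin.castSucc Y := by
    refine eq_of_coneMk_eq hd (one_sub_X_last_mul_mem_xHarmonic_iff.2 hP.1.1)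
      (rename_mem_xHarmonic hY.2) (Eq.trans ?_ hPY)
    rw [map_mul, map_sub, map_one]
    rfl
  have hY_zero : Y = 0 := by
    rw [← coneSlice_one_rename Y, ← h_eq, coneSlice_one_one_sub_X_last_mul]
  rw [hY_zero, map_zero]

end SobolevOrthogonal

/-! ### The differential operator along the rays of the cone -/

section Ray

variable {d : ℕ}

theorem conePoint_apply (ξ : UnitSphere d) (t : ℝ) (i : Fin (d + 1)) :
    conePoint ξ t i = t * conePoint ξ 1 i := by
  refine Fin.lastCases ?_ (fun j => ?_) i
  · simp only [conePoint, Fin.snoc_last, mul_one]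
  · simp only [conePoint, Fin.snoc_castSucc, one_mul]

/-- The derivative of `s ↦ P(s ξ, s)`. -/
def rayDeriv (ξ : UnitSphere d) (P : MvPolynomial (Fin (d + 1)) ℝ) (s : ℝ) : ℝ :=
  ∑ i, conePoint ξ 1 i * eval (conePoint ξ s) (pderiv i P)

theorem hasDerivAt_eval_conePoint (ξ : UnitSphere d) (P : MvPolynomial (Fin (d + 1)) ℝ) (s : ℝ) :
    HasDerivAt (fun s => eval (conePoint ξ s) P) (rayDeriv ξ P s) s :=
  hasDerivAt_eval (fun i => by
    simpa only [← conePoint_apply, id_eq, one_mul] using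
      (hasDerivAt_id s).mul_const (conePoint ξ 1 i)) P

theorem differentiable_rayDeriv (ξ : UnitSphere d) (P : MvPolynomial (Fin (d + 1)) ℝ) :
    Differentiable ℝ (rayDeriv ξ P) :=
  Differentiable.fun_sum fun i _ s =>
    ((hasDerivAt_eval_conePoint ξ (pderiv i P) s).differentiableAt.const_mul _)

theorem mul_rayDeriv (ξ : UnitSphere d) (P : MvPolynomial (Fin (d + 1)) ℝ) (s : ℝ) :
    s * rayDeriv ξ P s = eval (conePoint ξ s) (eulerOp (Fin (d + 1)) P) := by
  simp only [rayDeriv, Finset.mul_sum, eulerOp_apply, map_sum, map_mul, eval_X,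
    conePoint_apply ξ s, mul_assoc]

theorem mul_deriv_eval_conePoint (ξ : UnitSphere d) (P : MvPolynomial (Fin (d + 1)) ℝ) (t : ℝ) :
    t * deriv (fun s => eval (conePoint ξ s) P) t =
      eval (conePoint ξ t) (eulerOp (Fin (d + 1)) P) := by
  rw [(hasDerivAt_eval_conePoint ξ P t).deriv, mul_rayDeriv]

theorem sq_mul_iteratedDeriv_two_eval_conePoint (ξ : UnitSphere d)
    (P : MvPolynomial (Fin (d + 1)) ℝ) (t : ℝ) :
    t ^ 2 * iteratedDeriv 2 (fun s => eval (conePoint ξ s) P) t =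
      eval (conePoint ξ t)
        (eulerOp (Fin (d + 1)) (eulerOp (Fin (d + 1)) P) - eulerOp (Fin (d + 1)) P) := by
  have h_deriv : deriv (fun s => eval (conePoint ξ s) P) = rayDeriv ξ P :=
    funext fun s => (hasDerivAt_eval_conePoint ξ P s).deriv
  have h_euler : deriv (fun s => eval (conePoint ξ s) (eulerOp (Fin (d + 1)) P)) t =
      rayDeriv ξ P t + t * deriv (rayDeriv ξ P) t := by
    simp only [← mul_rayDeriv]
    simpa only [id_eq, one_mul] using
      ((hasDerivAt_id t).fun_mul (differentiable_rayDeriv ξ P t).hasDerivAt).deriv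
  rw [iteratedDeriv_succ, iteratedDeriv_one, h_deriv, map_sub, ← mul_deriv_eval_conePoint,
    h_euler, ← mul_rayDeriv]
  ring

theorem laplaceBeltrami_eval_conePoint {P : MvPolynomial (Fin (d + 1)) ℝ} (hP : P ∈ xHarmonic d)
    (ξ : UnitSphere d) (t : ℝ) :
    laplaceBeltrami (fun η => eval (conePoint η t) P) ξ =
      -eval (conePoint ξ t) (sphericalOp d P) := by
  have h := laplaceBeltrami_eval (coneSlice_mem_harmonicPoly t hP) ξ
  rw [eulerOp_coneSlice, eulerOp_coneSlice, ← map_smul, ← map_add, ← sphericalOp_eq_xEuler] at h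
  simp only [eval_coneSlice] at h
  exact h

theorem coneOperator_coneMk {P : MvPolynomial (Fin (d + 1)) ℝ} (hP : P ∈ xHarmonic d)
    (ξ : UnitSphere d) {t : ℝ} (ht : t ≠ 0) :
    coneOperator d (-1) (fun η s => coneVal η s (coneMk d P)) ξ t =
      coneVal ξ t (coneMk d (coneOp d P)) := by
  have h_radial : X (Fin.last d) * radialOp d P =
      eulerOp (Fin (d + 1)) (eulerOp (Fin (d + 1)) P) - eulerOp (Fin (d + 1)) P +
        ((d : ℝ) - 1) • eulerOp (Fin (d + 1)) P - sphericalOp d P := by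
    rw [X_last_mul_radialOp]
    ext m
    simp only [eulerOp_eq_xEuler_add, X_last_mul_pderiv_last, xEuler_eq_bidegreeScale, sphericalOp,
      coeff_add, coeff_sub, coeff_smul, coeff_bidegreeScale, smul_eq_mul]
    ring
  have h_eval := congrArg (eval (conePoint ξ t)) h_radial
  have h_last : eval (conePoint ξ t) (X (Fin.last d)) = t := by
    rw [eval_X, conePoint, Fin.snoc_last]
  rw [map_mul, h_last, map_sub, map_add, smul_eval, ← mul_deriv_eval_conePoint,
    ← sq_mul_iteratedDeriv_two_eval_conePoint] at h_eval
  simp only [coneVal_coneMk, aeval_eq_eval, coneOperator, laplaceBeltrami_eval_conePoint hP,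
    coneOp_apply, map_sub, map_mul, map_one, h_last]
  field_simp
  linear_combination (t - 1) * h_eval

theorem coneOperator_of_mem_sobolevSpace (hd : 2 ≤ d) (hβ : -(d : ℝ) < -1 + 1) {lam : ℝ}
    (hlam : lam ≠ 0) {n : ℕ} {Z : ConePoly d} (hZ : Z ∈ sobolevSpace hd (-1) hβ lam n)
    (ξ : UnitSphere d) {t : ℝ} (ht : t ≠ 0) :
    coneOperator d (-1) (fun η s => coneVal η s Z) ξ t =
      -((n : ℝ) * (n + d - 2)) * coneVal ξ t Z := by
  rw [sobolevSpace_eq_map] at hZ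
  obtain ⟨P, hP, rfl⟩ := hZ
  refine (coneOperator_coneMk hP.1.1 ξ ht).trans ?_
  rw [coneOp_eq_neg_smul hd hlam hP, map_smul, map_smul, smul_eq_mul]
  rfl

end Ray

end

theorem mainTheorem3_general (d : ℕ) (hd : 2 ≤ d) (lam : ℝ) (hlam : lam ≠ 0) (n : ℕ) :
    (∀ Z ∈ sobolevSpace hd (-1) (neg_natCast_lt_neg_one_add_one hd) lam n,
      ∀ (ξ : UnitSphere d), ∀ t : ℝ, t ≠ 0 →
        coneOperator d (-1) (fun η s => coneVal η s Z) ξ t =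
          -((n : ℝ) * (n + d - 2)) * coneVal ξ t Z) ∧
    (sobolevSpace hd (-1) (neg_natCast_lt_neg_one_add_one hd) lam n =
      coneSolidHarmonic d n ⊔
        (jacobiSpace hd (-1) 1 (neg_natCast_lt_neg_one hd) (by norm_num) (n - 1)).map
          (LinearMap.mulLeft ℝ (1 - coneT d)) ∧
    Disjoint (coneSolidHarmonic d n)
      ((jacobiSpace hd (-1) 1 (neg_natCast_lt_neg_one hd) (by norm_num) (n - 1)).map
          (LinearMap.mulLeft ℝ (1 - coneT d)))) :=
  ⟨fun _ hZ ξ _ ht => coneOperator_of_mem_sobolevSpace hd _ hlam hZ ξ ht,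
    sobolevSpace_eq_sup hd _ _ _ hlam n, disjoint_coneSolidHarmonic hd _ _ n _⟩

theorem mainTheorem3 (d : ℕ) (hd : 2 ≤ d) (lam : ℝ) (hlam : 0 < lam) (n : ℕ) :
    (∀ Z ∈ sobolevSpace hd (-1) (neg_natCast_lt_neg_one_add_one hd) lam n,
      ∀ (ξ : UnitSphere d), ∀ t ∈ Set.Ioc (0 : ℝ) 1,
        coneOperator d (-1) (fun η s => coneVal η s Z) ξ t =
          -((n : ℝ) * (n + d - 2)) * coneVal ξ t Z) ∧
    (sobolevSpace hd (-1) (neg_natCast_lt_neg_one_add_one hd) lam n =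
      coneSolidHarmonic d n ⊔
        (jacobiSpace hd (-1) 1 (neg_natCast_lt_neg_one hd) (by norm_num) (n - 1)).map
          (LinearMap.mulLeft ℝ (1 - coneT d)) ∧
    Disjoint (coneSolidHarmonic d n)
      ((jacobiSpace hd (-1) 1 (neg_natCast_lt_neg_one hd) (by norm_num) (n - 1)).map
          (LinearMap.mulLeft ℝ (1 - coneT d)))) := by
  have h := mainTheorem3_general d hd lam hlam.ne' n
  exact ⟨fun Z hZ ξ t ht => h.1 Z hZ ξ t ht.1.ne', h.2⟩
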